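/- Let $\hbar>0$ and let $\rho,B,V\in L^\infty(\mathbb R)$ be real-valued with $\rho\ge\underline\rho>0$ and $B\ge\underline B>0$ almost everywhere, and $\rho=\rho_\infty$, $B=B_\infty>0$, $V=V_\infty$ for $|x|\ge X_0$, where $0<X_0<X$. Put $\Omega=(-X,X)$ and $$\mathcal L_\Omega(w,\varphi)=\tfrac{\hbar^2}{2}(BDw,D\varphi)_{L^2(\Omega)}+(Vw,\varphi)_{L^2(\Omega)},\qquad w,\varphi\in H^1(\Omega).$$ Let $\dots<x_{-J}=-X<\dots<x_J=X<\dots$ be a mesh on $\mathbb R$ with $x_{-J+1}\le -X_0$, $x_{J-1}\ge X_0$ and $x_j-x_{j-1}=h$ for $j\le -J+1$ and for $j\ge J$. Let $n\ge1$ and let $H_h^{(n)}\subset H^1(\Omega)$ be the space of functions that are complex polynomials of degree at most $n$ on each element $[x_{j-1},x_j]$, $-J<j\le J$. Let $\tau=T/M$ with $T>0$ and an integer $M\ge1$, $\overline\partial_tY^m=(Y^m-Y^{m-1})/\tau$ and $\overline s_tY^m=(Y^{m-1}+Y^m)/2$. *Discrete transparent boundary condition.* The operators $\mathcal S^m$ are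 discrete convolutions, $\mathcal S^m\boldsymbol\Phi^m=\sum_{l=0}^mK^l\Phi^{m-l}$ for $\boldsymbol\Phi^m=\{\Phi^l\}_{l=0}^m$. The kernel $K$ is determined by the following property. Let $H$ be the space of functions in $H^1(0,\infty)$ that are polynomials of degree at most $n$ on each $[jh,(j+1)h]$, $j=0,1,\dots$. For any sequence $\Phi$ with $\Phi^0=0$ there are $\psi^m\in H$ with $\psi^0=0$, $\psi^m(0)=\Phi^m$ and, for all $m\ge1$ and $\varphi\in H$, $$i\hbar\rho_\infty(\overline\partial_t\psi^m,\varphi)_{L^2(0,\infty)}=\tfrac{\hbar^2}{2}B_\infty(D\,\overline s_t\psi^m,D\varphi)_{L^2(0,\infty)}+V_\infty(\overline s_t\psi^m,\varphi)_{L^2(0,\infty)}+\tfrac{\hbar^2}{2}B_\infty(\mathcal S^m\boldsymbol\Phi^m)\varphi^*(0).$$ *Scheme.* Let $F^0,\dots,F^M\in H^{-1}(\Omega)=[H^1(\Omega)]^*$, with the conjugate duality relation $\langle\cdot,\cdot\rangle_\Omega$. Let $\Psi^0,\dots,\Psi^M\in H_h^{(n)}$ satisfy $\Psi^0(\pm X)=0$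 and, for all $\varphi\in H_h^{(n)}$ and $1\le m\le M$, $$i\hbar(\rho\overline\partial_t\Psi^m,\varphi)_{L^2(\Omega)}=\mathcal L_\Omega(\overline s_t\Psi^m,\varphi)-\tfrac{\hbar^2}{2}B_\infty(\mathcal S^m\boldsymbol\Psi^m_X)\varphi^*(X)-\tfrac{\hbar^2}{2}B_\infty(\mathcal S^m\boldsymbol\Psi^m_{-X})\varphi^*(-X)+\langle F^m,\varphi\rangle_\Omega,$$ where $\boldsymbol\Psi^m_{\pm X}=\{\Psi^l(\pm X)\}_{l=0}^m$. *Norms.* Let $\hat v$ be a real number such that $V_\infty+\hat v\rho_\infty\ge0$ and $$\|w\|_{\mathcal H+\hat v\rho;\,\Omega}^2:=\mathcal L_\Omega(w,w)+\hat v\|\sqrt\rho\,w\|_{L^2(\Omega)}^2>0\quad\text{for any } w\in H^1(\Omega),\ w\not\equiv0,$$ and let $\|F\|_h^{(-1)}=\max\{|\langle F,\varphi\rangle_\Omega|:\ \varphi\in H_h^{(n)},\ \|\varphi\|_{\mathcal H+\hat v\rho;\,\Omega}=1\}$ for $F\in H^{-1}(\Omega)$. Then $$\max_{0\le m\le M}\|\Psi^m\|_{\mathcal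 H+\hat v\rho;\,\Omega}\le\|\Psi^0\|_{\mathcal H+\hat v\rho;\,\Omega}+4\sum_{m=1}^M\Bigl(\frac{|\hat v|}{\hbar}\|F^m\|_h^{(-1)}+\|\overline\partial_tF^m\|_h^{(-1)}\Bigr)\tau+4\|F^0\|_h^{(-1)}.$$ -/

import Mathlib

open MeasureTheory
open scoped ContDiff ComplexConjugate Polynomial

noncomputable section

namespace FEMTBC

/-! ### Sobolev spaces on an open set of the line -/

/-- The complex space `L²(I)`. -/
abbrev L2 (I : Set ℝ) : Type := Lp ℂ 2 (volume.restrict I)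

/-- `η` is a real test function on `I`. -/
def IsTest (I : Set ℝ) (η : ℝ → ℝ) : Prop :=
  ContDiff ℝ ∞ η ∧ HasCompactSupport η ∧ tsupport η ⊆ I

lemma IsTest.memLp {I : Set ℝ} {η : ℝ → ℝ} (hη : IsTest I η) :
    MemLp (fun x => (η x : ℂ)) 2 (volume.restrict I) := by
  have h : MemLp (fun x => (η x : ℂ)) 2 (volume : Measure ℝ) :=
    (Complex.continuous_ofReal.comp hη.1.continuous).memLp_of_hasCompactSupport
      (hη.2.1.comp_left (g := fun r : ℝ => (r : ℂ)) (by simp))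
  exact h.restrict I

lemma IsTest.deriv_memLp {I : Set ℝ} {η : ℝ → ℝ} (hη : IsTest I η) :
    MemLp (fun x => ((deriv η x : ℝ) : ℂ)) 2 (volume.restrict I) := by
  have h : MemLp (fun x => ((deriv η x : ℝ) : ℂ)) 2 (volume : Measure ℝ) :=
    (Complex.continuous_ofReal.comp
      (hη.1.continuous_deriv (by simp))).memLp_of_hasCompactSupport
      (hη.2.1.deriv.comp_left (g := fun r : ℝ => (r : ℂ)) (by simp))
  exact h.restrict I

lemma inner_toLp_ofReal {I : Set ℝ} {η : ℝ → ℝ}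
    (hη : MemLp (fun x => (η x : ℂ)) 2 (volume.restrict I)) (w : L2 I) :
    inner ℂ (hη.toLp _) w = ∫ x in I, (η x : ℂ) * w x := by
  rw [L2.inner_def]
  apply integral_congr_ae
  filter_upwards [hη.coeFn_toLp] with x hx
  rw [hx]
  simp [mul_comm]

/-- The pair `(w, g)` satisfies `D w = g` on `I` in the weak sense. -/
def IsWeakDeriv (I : Set ℝ) (w g : L2 I) : Prop :=
  ∀ η : ℝ → ℝ, IsTest I η →
    ∫ x in I, ((deriv η x : ℝ) : ℂ) * w x = - ∫ x in I, (η x : ℂ) * g x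

lemma isWeakDeriv_iff {I : Set ℝ} (w g : L2 I) :
    IsWeakDeriv I w g ↔ ∀ (η : ℝ → ℝ) (hη : IsTest I η),
      inner ℂ (hη.deriv_memLp.toLp _) w + inner ℂ (hη.memLp.toLp _) g = 0 := by
  refine forall₂_congr fun η hη => ?_
  rw [inner_toLp_ofReal hη.deriv_memLp, inner_toLp_ofReal hη.memLp, eq_neg_iff_add_eq_zero]

/-- The complex Sobolev space `H¹(I)`: pairs `(w, D w)` in `L²(I) × L²(I)`, with the norm
`(‖w‖² + ‖D w‖²)^{1/2}`. -/
def H1 (I : Set ℝ) : Submodule ℂ (WithLp 2 (L2 I × L2 I)) where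
  carrier := {u | IsWeakDeriv I u.fst u.snd}
  zero_mem' := by
    rw [Set.mem_ofPred_eq, isWeakDeriv_iff]
    intro η hη
    simp
  add_mem' := by
    intro u v hu hv
    rw [Set.mem_ofPred_eq, isWeakDeriv_iff] at *
    intro η hη
    have h1 := hu η hη
    have h2 := hv η hη
    simp only [WithLp.add_fst, WithLp.add_snd, inner_add_right]
    linear_combination h1 + h2
  smul_mem' := by
    intro c u hu
    rw [Set.mem_ofPred_eq, isWeakDeriv_iff] at *
    intro η hη
    have h1 := hu η hη
    simp only [WithLp.smul_fst, WithLp.smul_snd, inner_smul_right]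
    linear_combination c * h1

/-- The function `w` of an element of `H¹(I)`. -/
def val {I : Set ℝ} (u : H1 I) : L2 I := (u : WithLp 2 (L2 I × L2 I)).fst

/-- The weak derivative `D w` of an element of `H¹(I)`. -/
def D {I : Set ℝ} (u : H1 I) : L2 I := (u : WithLp 2 (L2 I × L2 I)).snd

/-- `H⁻¹(I) = [H¹(I)]^*`: bounded conjugate-linear functionals on `H¹(I)`. The value `F φ` is the
conjugate duality relation `⟨F, φ⟩`. -/
abbrev Hneg1 (I : Set ℝ) : Type := H1 I →L⋆[ℂ] ℂ

/-! ### Forms -/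

/-- `(ρ w, φ)_{L²(I)}`. -/
def massForm (I : Set ℝ) (ρ : ℝ → ℝ) (w φ : H1 I) : ℂ :=
  ∫ x in I, (ρ x : ℂ) * val w x * conj (val φ x)

/-- `𝓛_I(w, φ) = (ħ²/2) (B D w, D φ)_{L²(I)} + (V w, φ)_{L²(I)}`. -/
def formL (I : Set ℝ) (ħ : ℝ) (B V : ℝ → ℝ) (w φ : H1 I) : ℂ :=
  ((ħ ^ 2 / 2 : ℝ) : ℂ) * (∫ x in I, (B x : ℂ) * D w x * conj (D φ x)) +
    ∫ x in I, (V x : ℂ) * val w x * conj (val φ x)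

/-- `𝓛_I(w, w) + v ‖√ρ w‖²`, where `v` is the shift (`𝓛_I(w, w)` is real). -/
def energySq (I : Set ℝ) (ħ : ℝ) (ρ B V : ℝ → ℝ) (v : ℝ) (w : H1 I) : ℝ :=
  (formL I ħ B V w w).re + v * ∫ x in I, ρ x * ‖val w x‖ ^ 2

/-- The "energy" norm with shift `v`. -/
def energyNorm (I : Set ℝ) (ħ : ℝ) (ρ B V : ℝ → ℝ) (v : ℝ) (w : H1 I) : ℝ :=
  Real.sqrt (energySq I ħ ρ B V v w)

/-! ### Finite elements -/

/-- The functions `u ∈ H¹(I)` that are complex polynomials of degree at most `n` on each of the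
elements `Δ j`. -/
def FESpace (I : Set ℝ) {ι : Type} (Δ : ι → Set ℝ) (n : ℕ) : Submodule ℂ (H1 I) where
  carrier := {u | ∀ j, ∃ p : ℂ[X], p.natDegree ≤ n ∧
    ∀ᵐ x ∂((volume.restrict I).restrict (Δ j)), val u x = p.eval (x : ℂ)}
  zero_mem' := by
    intro j
    refine ⟨0, by simp, ?_⟩
    have h : ∀ᵐ x ∂((volume.restrict I).restrict (Δ j)), (0 : L2 I) x = 0 :=
      ae_restrict_of_ae (Lp.coeFn_zero ℂ 2 (volume.restrict I))
    filter_upwards [h] with x hx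
    simpa [val] using hx
  add_mem' := by
    intro u v hu hv j
    obtain ⟨p, hp, hpu⟩ := hu j
    obtain ⟨q, hq, hqv⟩ := hv j
    refine ⟨p + q, (Polynomial.natDegree_add_le p q).trans (max_le hp hq), ?_⟩
    filter_upwards [hpu, hqv, ae_restrict_of_ae (Lp.coeFn_add (val u) (val v))] with x h1 h2 h3
    rw [Polynomial.eval_add, ← h1, ← h2]
    exact h3
  smul_mem' := by
    intro c u hu j
    obtain ⟨p, hp, hpu⟩ := hu j
    refine ⟨c • p, (Polynomial.natDegree_smul_le c p).trans hp, ?_⟩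
    filter_upwards [hpu, ae_restrict_of_ae (Lp.coeFn_smul c (val u))] with x h1 h2
    rw [Polynomial.eval_smul, ← h1]
    exact h2

/-- The value at `x` of `u` from the element `Δ`: the value at `x` of the polynomial that equals
`u` on `Δ`. For `x` in the closure of `Δ` this is the value of the continuous representative
of `u`. -/
def valueAt {I : Set ℝ} (Δ : Set ℝ) (x : ℝ) (u : H1 I) : ℂ :=
  (Classical.epsilon fun p : ℂ[X] =>
    ∀ᵐ y ∂((volume.restrict I).restrict Δ), val u y = p.eval (y : ℂ)).eval (x : ℂ)

/-- `∂̄_t Y^m = (Y^m - Y^{m-1}) / τ` for `m ≥ 1`. -/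
def backDiff {E : Type*} [AddCommGroup E] [Module ℂ E] (τ : ℝ) (Y : ℕ → E) (m : ℕ) : E :=
  (τ : ℂ)⁻¹ • (Y m - Y (m - 1))

/-- `s̄_t Y^m = (Y^{m-1} + Y^m) / 2` for `m ≥ 1`. -/
def halfSum {E : Type*} [AddCommGroup E] [Module ℂ E] (Y : ℕ → E) (m : ℕ) : E :=
  (2 : ℂ)⁻¹ • (Y (m - 1) + Y m)

/-! ### The discrete transparent boundary condition -/

/-- The elements of the uniform mesh `0 < h < 2h < …` on the half-axis. -/
def halfElement (h : ℝ) (j : ℕ) : Set ℝ := Set.Ioo (j * h) ((j + 1) * h)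

/-- The finite element space on the half-axis `(0, ∞)` with the uniform mesh of step `h`. -/
def FEHalf (h : ℝ) (n : ℕ) : Submodule ℂ (H1 (Set.Ioi 0)) :=
  FESpace (Set.Ioi 0) (halfElement h) n

/-- The value `φ(0)` of a finite element function on the half-axis. -/
def valueZero (h : ℝ) (u : H1 (Set.Ioi 0)) : ℂ := valueAt (halfElement h 0) 0 u

/-- The discrete convolution `∑_{l=0}^m K^l Φ^{m-l}`. -/
def discreteConv (K Φ : ℕ → ℂ) (m : ℕ) : ℂ := ∑ l ∈ Finset.range (m + 1), K l * Φ (m - l)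

/-- `K` is a kernel of the discrete transparent boundary condition, for the half-axis with
constant coefficients `ρ, B, V`, the uniform mesh of step `h`, degree `n` and time step `τ`.
For any history `Φ` with `Φ^0 = 0`, the Crank-Nicolson finite element scheme on the half-axis
(outside of the computational domain, the end of which is put at `0`) with zero initial value and
with the Dirichlet values `Φ^m` at `0` has a solution in `H¹(0, ∞)` whose discrete derivative
at `0`, averaged over the time step, is the convolution `∑_{l=0}^m K^l Φ^{m-l}`. -/
def IsTBCKernel (ħ ρ B V h τ : ℝ) (n : ℕ) (K : ℕ → ℂ) : Prop :=
  ∀ Φ : ℕ → ℂ, Φ 0 = 0 → ∃ ψ : ℕ → H1 (Set.Ioi 0),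
    (∀ m, ψ m ∈ FEHalf h n) ∧ ψ 0 = 0 ∧ (∀ m, valueZero h (ψ m) = Φ m) ∧
    ∀ m, 1 ≤ m → ∀ φ ∈ FEHalf h n,
      Complex.I * ħ * massForm (Set.Ioi 0) (fun _ => ρ) (backDiff τ ψ m) φ =
        formL (Set.Ioi 0) ħ (fun _ => B) (fun _ => V) (halfSum ψ m) φ +
          ((ħ ^ 2 / 2 * B : ℝ) : ℂ) * discreteConv K Φ m * conj (valueZero h φ)

/-- The kernel of the discrete transparent boundary condition; its normalizing constant factor is
included in it. It exists by `exists_isTBCKernel` below. -/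
def tbcKernel (ħ ρ B V h τ : ℝ) (n : ℕ) : ℕ → ℂ :=
  Classical.epsilon (IsTBCKernel ħ ρ B V h τ n)

/-- The operator `S_ref^m Φ^m` of the discrete transparent boundary condition. -/
def SRef (ħ ρ B V h τ : ℝ) (n : ℕ) (Φ : ℕ → ℂ) (m : ℕ) : ℂ :=
  discreteConv (tbcKernel ħ ρ B V h τ n) Φ m

/-! ### Existence of the kernel -/

section

variable {W E : Type*} [NormedAddCommGroup W] [InnerProductSpace ℂ W] [CompleteSpace W]
    [NormedAddCommGroup E] [InnerProductSpace ℂ E] [CompleteSpace E]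

lemma solve_aux (P Q : W →L[ℂ] E) (hn : ∀ u, ‖u‖ ^ 2 = ‖P u‖ ^ 2 + ‖Q u‖ ^ 2) {a b c : ℝ}
    (ha : 0 < a) (hb : 0 < b) (p q : E) :
    ∃ u : W, ∀ φ : W, inner ℂ (P φ) ((Complex.I * a - c) • P u + p) -
      inner ℂ (Q φ) ((b : ℂ) • Q u + q) = 0 := by
  set T : W →L[ℂ] W := (Complex.I * a - c : ℂ) • (P.adjoint ∘L P) - (b : ℂ) • (Q.adjoint ∘L Q)
    with hT
  have hTi : ∀ x φ, inner ℂ φ (T x) = inner ℂ (P φ) ((Complex.I * a - c : ℂ) • P x) -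
      inner ℂ (Q φ) ((b : ℂ) • Q x) := by
    intro x φ
    simp [hT, ContinuousLinearMap.adjoint_inner_right]
  have hunit : IsUnit T := by
    have hκ : 0 < 1 / a + (1 + |c| / a) / b := by positivity
    refine ContinuousLinearMap.isUnit_of_forall_le_norm_inner_map T
      (c := ⟨(1 / a + (1 + |c| / a) / b)⁻¹, by positivity⟩) ?_ ?_
    · exact_mod_cast (inv_pos.mpr hκ)
    · intro x
      have h1 : inner ℂ x (T x) = (Complex.I * a - c) * ((‖P x‖ ^ 2 : ℝ) : ℂ) -
          b * ((‖Q x‖ ^ 2 : ℝ) : ℂ) := by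
        rw [hTi, inner_smul_right, inner_smul_right, inner_self_eq_norm_sq_to_K,
          inner_self_eq_norm_sq_to_K]
        push_cast
        rfl
      rw [norm_inner_symm, hn]
      set z := inner ℂ x (T x)
      have him : z.im = a * ‖P x‖ ^ 2 := by
        rw [h1]; simp [-Complex.ofReal_pow]
      have hre : z.re = - c * ‖P x‖ ^ 2 - b * ‖Q x‖ ^ 2 := by
        rw [h1]; simp [-Complex.ofReal_pow]
      have i1 := Complex.abs_im_le_norm z
      have i2 := Complex.abs_re_le_norm z
      change (‖P x‖ ^ 2 + ‖Q x‖ ^ 2) * (1 / a + (1 + |c| / a) / b)⁻¹ ≤ ‖z‖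
      rw [← div_eq_mul_inv, div_le_iff₀ hκ]
      have hx : ‖P x‖ ^ 2 ≤ ‖z‖ / a := by
        rw [le_div_iff₀ ha]
        linarith [le_abs_self z.im]
      have hy : ‖Q x‖ ^ 2 ≤ (‖z‖ + |c| * (‖z‖ / a)) / b := by
        rw [le_div_iff₀ hb]
        have : - c * ‖P x‖ ^ 2 ≤ |c| * (‖z‖ / a) :=
          mul_le_mul (neg_le_abs c) hx (by positivity) (abs_nonneg c)
        linarith [neg_abs_le z.re]
      calc _ ≤ ‖z‖ / a + (‖z‖ + |c| * (‖z‖ / a)) / b := add_le_add hx hy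
        _ = _ := by field_simp
  obtain ⟨S, hS⟩ := hunit.exists_right_inv
  refine ⟨S (Q.adjoint q - P.adjoint p), fun φ => ?_⟩
  have := hTi (S (Q.adjoint q - P.adjoint p)) φ
  have h2 : T (S (Q.adjoint q - P.adjoint p)) = Q.adjoint q - P.adjoint p := by
    have := congrArg (fun A : W →L[ℂ] W => A (Q.adjoint q - P.adjoint p)) hS
    simpa using this
  rw [h2, inner_sub_right, ContinuousLinearMap.adjoint_inner_right,
    ContinuousLinearMap.adjoint_inner_right] at this
  rw [inner_add_right, inner_add_right]
  linear_combination -this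

lemma step_aux (P Q : W →L[ℂ] E) (hn : ∀ u, ‖u‖ ^ 2 = ‖P u‖ ^ 2 + ‖Q u‖ ^ 2) {a b c : ℝ}
    (ha : 0 < a) (hb : 0 < b) (t : W →L[ℂ] ℂ) (w : W) (hw : t w = 1) (v : W) (g : ℂ) :
    ∃ u : W, t u = g ∧ ∃ κ : ℂ, ∀ φ : W,
      inner ℂ (P φ) ((Complex.I * a) • (P u - P v) - (c : ℂ) • (P u + P v)) -
        inner ℂ (Q φ) ((b : ℂ) • (Q u + Q v)) = κ * conj (t φ) := by
  let W0 : Submodule ℂ W := LinearMap.ker (t : W →ₗ[ℂ] ℂ)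
  have hc : IsClosed (W0 : Set W) := t.isClosed_ker
  have : CompleteSpace W0 := hc.completeSpace_coe
  obtain ⟨u0, hu0⟩ := solve_aux (W := W0) (P ∘L W0.subtypeL) (Q ∘L W0.subtypeL)
    (fun u => hn u) (c := c) ha hb
    ((Complex.I * a - c) • (g • P w) - (Complex.I * a + c) • P v) ((b : ℂ) • (g • Q w + Q v))
  have ht0 : t (u0 : W) = 0 := u0.2
  refine ⟨g • w + u0, by simp [hw, ht0], ?_⟩
  set u := g • w + (u0 : W) with hu
  let R : W → ℂ := fun φ =>
    inner ℂ (P φ) ((Complex.I * a) • (P u - P v) - (c : ℂ) • (P u + P v)) -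
        inner ℂ (Q φ) ((b : ℂ) • (Q u + Q v))
  refine ⟨R w, fun φ => ?_⟩
  have hmem : φ - t φ • w ∈ W0 := by
    change t (φ - t φ • w) = 0
    simp [hw]
  have h0 : R (φ - t φ • w) = 0 := by
    rw [← hu0 ⟨_, hmem⟩]
    simp only [R, hu, map_add, map_smul, ContinuousLinearMap.comp_apply,
      Submodule.subtypeL_apply]
    congr 2 <;> module
  have h1 : R (φ - t φ • w) = R φ - conj (t φ) * R w := by
    simp only [R, map_sub, map_smul, inner_sub_left, inner_smul_left]
    ring
  change R φ = _
  rw [h1] at h0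
  linear_combination h0

lemma impulse_aux (P Q : W →L[ℂ] E) (hn : ∀ u, ‖u‖ ^ 2 = ‖P u‖ ^ 2 + ‖Q u‖ ^ 2) {a b c : ℝ}
    (ha : 0 < a) (hb : 0 < b) (t : W →L[ℂ] ℂ) (w : W) (hw : t w = 1) :
    ∃ (e : ℕ → W) (κ : ℕ → ℂ), e 0 = 0 ∧ t (e 1) = 1 ∧ (∀ m, t (e (m + 2)) = 0) ∧
      ∀ m φ, inner ℂ (P φ) ((Complex.I * a) • (P (e (m + 1)) - P (e m)) -
        (c : ℂ) • (P (e (m + 1)) + P (e m))) -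
        inner ℂ (Q φ) ((b : ℂ) • (Q (e (m + 1)) + Q (e m))) = κ m * conj (t φ) := by
  choose s hs κ hκ using fun v g => step_aux P Q hn (c := c) ha hb t w hw v g
  let e : ℕ → W := fun m => Nat.rec 0 (fun m v => s v (if m = 0 then 1 else 0)) m
  have he : ∀ m, e (m + 1) = s (e m) (if m = 0 then 1 else 0) := fun m => rfl
  refine ⟨e, fun m => κ (e m) (if m = 0 then 1 else 0), rfl, ?_, ?_, ?_⟩
  · exact (hs _ _).trans (if_pos rfl)
  · intro m; rw [he (m + 1), hs]; simp
  · intro m φ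
    rw [he m]; exact hκ _ _ φ

lemma kernel_aux (P Q : W →L[ℂ] E) (hn : ∀ u, ‖u‖ ^ 2 = ‖P u‖ ^ 2 + ‖Q u‖ ^ 2) {a b c : ℝ}
    (ha : 0 < a) (hb : 0 < b) (t : W →L[ℂ] ℂ) (w : W) (hw : t w = 1) :
    ∃ κ : ℕ → ℂ, ∀ Φ : ℕ → ℂ, Φ 0 = 0 → ∃ ψ : ℕ → W, ψ 0 = 0 ∧ (∀ m, t (ψ m) = Φ m) ∧
      ∀ m, ∀ φ, inner ℂ (P φ) ((Complex.I * a) • (P (ψ (m + 1)) - P (ψ m)) -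
        (c : ℂ) • (P (ψ (m + 1)) + P (ψ m))) -
        inner ℂ (Q φ) ((b : ℂ) • (Q (ψ (m + 1)) + Q (ψ m))) =
          (∑ l ∈ Finset.range (m + 1 + 1), κ l * Φ (m + 1 - l)) * conj (t φ) := by
  obtain ⟨e, κ, e0, e1, e2, he⟩ := impulse_aux P Q hn (c := c) ha hb t w hw
  refine ⟨κ, fun Φ hΦ => ⟨fun m => ∑ l ∈ Finset.range (m + 1), Φ (m - l) • e (l + 1), ?_, ?_, ?_⟩⟩
  · simp [hΦ]
  · intro m
    rw [map_sum, Finset.sum_range_succ']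
    simp [e1, e2]
  · intro m φ
    have hshift : ∑ l ∈ Finset.range (m + 1), Φ (m - l) • e (l + 1) =
        ∑ l ∈ Finset.range (m + 1 + 1), Φ (m + 1 - l) • e l := by
      rw [Finset.sum_range_succ' (fun l => Φ (m + 1 - l) • e l)]
      simp [e0]
    simp only [hshift, map_sum, map_smul, Finset.sum_mul]
    rw [← Finset.sum_sub_distrib, ← Finset.sum_add_distrib, ← Finset.sum_add_distrib,
      Finset.smul_sum, Finset.smul_sum, Finset.smul_sum, ← Finset.sum_sub_distrib, inner_sum,
      inner_sum, ← Finset.sum_sub_distrib]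
    refine Finset.sum_congr rfl fun l _ => ?_
    have h := he l φ
    simp only [inner_sub_right, inner_add_right, inner_smul_right] at h ⊢
    linear_combination (Φ (m + 1 - l)) * h

lemma kernel_sub_aux (S : Submodule ℂ W) (hS : IsClosed (S : Set W)) (P Q : W →L[ℂ] E)
    (hn : ∀ u, ‖u‖ ^ 2 = ‖P u‖ ^ 2 + ‖Q u‖ ^ 2) {a b c : ℝ}
    (ha : 0 < a) (hb : 0 < b) (t : S →L[ℂ] ℂ) (w : S) (hw : t w = 1) :
    ∃ κ : ℕ → ℂ, ∀ Φ : ℕ → ℂ, Φ 0 = 0 → ∃ ψ : ℕ → S, ψ 0 = 0 ∧ (∀ m, t (ψ m) = Φ m) ∧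
      ∀ m, ∀ φ : S, inner ℂ (P φ) ((Complex.I * a) • (P (ψ (m + 1)) - P (ψ m)) -
        (c : ℂ) • (P (ψ (m + 1)) + P (ψ m))) -
        inner ℂ (Q φ) ((b : ℂ) • (Q (ψ (m + 1)) + Q (ψ m))) =
          (∑ l ∈ Finset.range (m + 1 + 1), κ l * Φ (m + 1 - l)) * conj (t φ) := by
  have : CompleteSpace S := hS.completeSpace_coe
  exact kernel_aux (P ∘L S.subtypeL) (Q ∘L S.subtypeL) (fun u => hn u) ha hb t w hw

end

lemma isClosed_H1 (I : Set ℝ) : IsClosed (H1 I : Set (WithLp 2 (L2 I × L2 I))) := by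
  have h : (H1 I : Set (WithLp 2 (L2 I × L2 I))) =
      ⋂ (η : ℝ → ℝ) (hη : IsTest I η), {u | inner ℂ (hη.deriv_memLp.toLp _)
        (WithLp.fstL 2 ℂ (L2 I) (L2 I) u) + inner ℂ (hη.memLp.toLp _)
        (WithLp.sndL 2 ℂ (L2 I) (L2 I) u) = 0} := by
    ext u
    simp only [Set.mem_iInter]
    exact isWeakDeriv_iff u.fst u.snd
  rw [h]
  refine isClosed_iInter fun η => isClosed_iInter fun hη => isClosed_eq ?_ continuous_const
  fun_prop

instance (I : Set ℝ) : CompleteSpace (H1 I) := (isClosed_H1 I).completeSpace_coe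

/-- `val` as a bounded operator. -/
def valL (I : Set ℝ) : H1 I →L[ℂ] L2 I := WithLp.fstL 2 ℂ (L2 I) (L2 I) ∘L (H1 I).subtypeL

/-- `D` as a bounded operator. -/
def DL (I : Set ℝ) : H1 I →L[ℂ] L2 I := WithLp.sndL 2 ℂ (L2 I) (L2 I) ∘L (H1 I).subtypeL

lemma H1_norm_sq {I : Set ℝ} (u : H1 I) : ‖u‖ ^ 2 = ‖valL I u‖ ^ 2 + ‖DL I u‖ ^ 2 :=
  WithLp.prod_norm_sq_eq_of_L2 (u : WithLp 2 (L2 I × L2 I))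

lemma massForm_const (I : Set ℝ) (r : ℝ) (w φ : H1 I) :
    massForm I (fun _ => r) w φ = r * inner ℂ (valL I φ) (valL I w) := by
  rw [L2.inner_def, ← integral_const_mul]
  refine integral_congr_ae (Filter.Eventually.of_forall fun x => ?_)
  change (r : ℂ) * val w x * conj (val φ x) = r * inner ℂ (val φ x) (val w x)
  simp [mul_assoc]

lemma formL_const (I : Set ℝ) (ħ B V : ℝ) (w φ : H1 I) :
    formL I ħ (fun _ => B) (fun _ => V) w φ =
      ((ħ ^ 2 / 2 * B : ℝ) : ℂ) * inner ℂ (DL I φ) (DL I w) +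
        V * inner ℂ (valL I φ) (valL I w) := by
  have h := massForm_const I V w φ
  rw [massForm] at h
  rw [formL, h, L2.inner_def]
  congr 1
  rw [Complex.ofReal_mul, mul_assoc]
  congr 1
  refine Eq.trans ?_ (integral_const_mul (B : ℂ) _)
  refine integral_congr_ae (Filter.Eventually.of_forall fun x => ?_)
  change (B : ℂ) * D w x * conj (D φ x) = B * inner ℂ (D φ x) (D w x)
  simp [mul_assoc]

/-- Two polynomials that are equal almost everywhere on an interval are equal. -/
lemma poly_eq_of_ae {a b : ℝ} (hab : a < b) {p q : ℂ[X]}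
    (h : ∀ᵐ x : ℝ ∂(volume.restrict (Set.Ioo a b)), p.eval (x : ℂ) = q.eval (x : ℂ)) : p = q := by
  have hinf : {x : ℝ | p.eval (x : ℂ) = q.eval (x : ℂ)}.Infinite := by
    intro hfin
    have h0 : volume ({x : ℝ | p.eval (x : ℂ) = q.eval (x : ℂ)}) = 0 := hfin.measure_zero _
    rw [ae_iff] at h
    have h2 : volume (Set.Ioo a b) ≤ 0 := by
      calc volume (Set.Ioo a b) = (volume.restrict (Set.Ioo a b)) Set.univ := by simp
        _ ≤ (volume.restrict (Set.Ioo a b)) {x : ℝ | ¬ p.eval (x : ℂ) = q.eval (x : ℂ)} +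
            (volume.restrict (Set.Ioo a b)) {x : ℝ | p.eval (x : ℂ) = q.eval (x : ℂ)} := by
            refine (measure_mono ?_).trans (measure_union_le _ _)
            intro x _
            by_cases hx : p.eval (x : ℂ) = q.eval (x : ℂ)
            · exact Or.inr hx
            · exact Or.inl hx
        _ ≤ 0 + 0 := by
            refine add_le_add h.le ?_
            exact (Measure.restrict_apply_le _ _).trans h0.le
        _ = 0 := by simp
    rw [Real.volume_Ioo] at h2
    simp at h2
    linarith
  refine Polynomial.eq_of_infinite_eval_eq p q ?_
  refine (hinf.image (f := fun x : ℝ => (x : ℂ)) Complex.ofReal_injective.injOn).mono ?_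
  rintro _ ⟨x, hx, rfl⟩
  exact hx

lemma restrict_element {I : Set ℝ} {a b : ℝ} (hI : Set.Ioo a b ⊆ I) :
    (volume.restrict I).restrict (Set.Ioo a b) = volume.restrict (Set.Ioo a b) := by
  rw [Measure.restrict_restrict measurableSet_Ioo, Set.inter_eq_left.mpr hI]

/-- `valueAt` is the value of the polynomial. -/
lemma valueAt_eq {I : Set ℝ} {a b : ℝ} (hab : a < b) (hI : Set.Ioo a b ⊆ I) (x : ℝ) (u : H1 I)
    (p : ℂ[X])
    (hp : ∀ᵐ y ∂((volume.restrict I).restrict (Set.Ioo a b)), val u y = p.eval (y : ℂ)) :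
    valueAt (Set.Ioo a b) x u = p.eval (x : ℂ) := by
  have h := Classical.epsilon_spec (p := fun p : ℂ[X] =>
    ∀ᵐ y ∂((volume.restrict I).restrict (Set.Ioo a b)), val u y = p.eval (y : ℂ)) ⟨p, hp⟩
  rw [valueAt]
  congr 1
  refine poly_eq_of_ae hab ?_
  have h3 : ∀ᵐ y : ℝ ∂((volume.restrict I).restrict (Set.Ioo a b)), (Classical.epsilon
      fun p : ℂ[X] => ∀ᵐ y ∂((volume.restrict I).restrict (Set.Ioo a b)),
        val u y = p.eval (y : ℂ)).eval (y : ℂ) = p.eval (y : ℂ) := by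
    filter_upwards [h, hp] with y h1 h2
    rw [← h1, ← h2]
  exact (restrict_element hI) ▸ h3

lemma memLp_poly {I : Set ℝ} (a b : ℝ) (p : ℂ[X]) :
    MemLp (fun x : ℝ => p.eval (x : ℂ)) 2 ((volume.restrict I).restrict (Set.Ioo a b)) := by
  have hc : Continuous (fun x : ℝ => p.eval (x : ℂ)) :=
    p.continuous.comp Complex.continuous_ofReal
  obtain ⟨C, hC⟩ := isCompact_Icc.exists_bound_of_continuousOn (hc.continuousOn (s := Set.Icc a b))
  have h : MemLp (fun x : ℝ => p.eval (x : ℂ)) 2 (volume.restrict (Set.Icc a b)) :=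
    MemLp.of_bound hc.aestronglyMeasurable C
      ((ae_restrict_iff' measurableSet_Icc).mpr (Filter.Eventually.of_forall hC))
  refine h.mono_measure ?_
  rw [Measure.restrict_restrict measurableSet_Ioo]
  exact Measure.restrict_mono (Set.inter_subset_left.trans Set.Ioo_subset_Icc_self) le_rfl

/-- The polynomials of degree at most `n` as elements of `L²` of an element. -/
def polyL (I : Set ℝ) (a b : ℝ) (n : ℕ) :
    Polynomial.degreeLE ℂ n →ₗ[ℂ] Lp ℂ 2 ((volume.restrict I).restrict (Set.Ioo a b)) where
  toFun p := (memLp_poly a b (p : ℂ[X])).toLp _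
  map_add' p q := by
    rw [← MemLp.toLp_add]
    exact MemLp.toLp_congr _ _ (Filter.Eventually.of_forall fun x => by simp)
  map_smul' c p := by
    rw [RingHom.id_apply, ← MemLp.toLp_const_smul]
    exact MemLp.toLp_congr _ _ (Filter.Eventually.of_forall fun x => by simp)

/-- The restriction to an element. -/
def resL (I : Set ℝ) (a b : ℝ) :
    H1 I →L[ℂ] Lp ℂ 2 ((volume.restrict I).restrict (Set.Ioo a b)) :=
  LpToLpRestrictCLM ℝ ℂ ℂ (volume.restrict I) 2 (Set.Ioo a b) ∘L valL I

instance (n : ℕ) : FiniteDimensional ℂ (Polynomial.degreeLE ℂ n) := by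
  have h : Polynomial.degreeLE ℂ n = Polynomial.degreeLT ℂ (n + 1) := by
    rw [Polynomial.degreeLT_succ_eq_degreeLE]
  rw [h]
  exact Module.Finite.equiv (Polynomial.degreeLTEquiv ℂ (n + 1)).symm

lemma resL_eq_iff {I : Set ℝ} {a b : ℝ} {n : ℕ} (u : H1 I) (p : Polynomial.degreeLE ℂ n) :
    polyL I a b n p = resL I a b u ↔
      ∀ᵐ x ∂((volume.restrict I).restrict (Set.Ioo a b)), val u x = (p : ℂ[X]).eval (x : ℂ) := by
  have h1 : resL I a b u =ᵐ[(volume.restrict I).restrict (Set.Ioo a b)] val u :=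
    LpToLpRestrictCLM_coeFn ℂ (Set.Ioo a b) (val u)
  have h2 : polyL I a b n p =ᵐ[(volume.restrict I).restrict (Set.Ioo a b)]
    fun x : ℝ => (p : ℂ[X]).eval (x : ℂ) := (memLp_poly a b (p : ℂ[X])).coeFn_toLp
  rw [Lp.ext_iff]
  constructor
  · intro h
    filter_upwards [h, h1, h2] with x h h1 h2
    rw [← h1, ← h2, h]
  · intro h
    filter_upwards [h, h1, h2] with x h h1 h2
    rw [h1, h2, h]

lemma mem_FESpace_iff {I : Set ℝ} {ι : Type} {a b : ι → ℝ} {n : ℕ} (u : H1 I) :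
    u ∈ FESpace I (fun j => Set.Ioo (a j) (b j)) n ↔
      ∀ j, resL I (a j) (b j) u ∈ LinearMap.range (polyL I (a j) (b j) n) := by
  refine forall_congr' fun j => ?_
  constructor
  · rintro ⟨p, hp, h⟩
    exact ⟨⟨p, Polynomial.mem_degreeLE.mpr (Polynomial.natDegree_le_iff_degree_le.mp hp)⟩,
      (resL_eq_iff u _).mpr h⟩
  · rintro ⟨p, h⟩
    exact ⟨p, Polynomial.natDegree_le_iff_degree_le.mpr (Polynomial.mem_degreeLE.mp p.2),
      (resL_eq_iff u _).mp h⟩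

lemma isClosed_FESpace {I : Set ℝ} {ι : Type} (a b : ι → ℝ) (n : ℕ) :
    IsClosed (FESpace I (fun j => Set.Ioo (a j) (b j)) n : Set (H1 I)) := by
  have h : (FESpace I (fun j => Set.Ioo (a j) (b j)) n : Set (H1 I)) =
      ⋂ j, resL I (a j) (b j) ⁻¹' (LinearMap.range (polyL I (a j) (b j) n) : Set _) := by
    ext u
    rw [Set.mem_iInter]
    exact mem_FESpace_iff u
  rw [h]
  exact isClosed_iInter fun j =>
    (Submodule.closed_of_finiteDimensional _).preimage (resL I (a j) (b j)).continuous

lemma polyL_injective {I : Set ℝ} {a b : ℝ} (hab : a < b) (hI : Set.Ioo a b ⊆ I) (n : ℕ) :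
    Function.Injective (polyL I a b n) := by
  intro p q hpq
  have h1 : polyL I a b n p =ᵐ[(volume.restrict I).restrict (Set.Ioo a b)]
    fun x : ℝ => (p : ℂ[X]).eval (x : ℂ) := (memLp_poly a b (p : ℂ[X])).coeFn_toLp
  have h2 : polyL I a b n q =ᵐ[(volume.restrict I).restrict (Set.Ioo a b)]
    fun x : ℝ => (q : ℂ[X]).eval (x : ℂ) := (memLp_poly a b (q : ℂ[X])).coeFn_toLp
  rw [hpq] at h1
  have h3 : ∀ᵐ x : ℝ ∂((volume.restrict I).restrict (Set.Ioo a b)),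
      (p : ℂ[X]).eval (x : ℂ) = (q : ℂ[X]).eval (x : ℂ) := by
    filter_upwards [h1, h2] with x h1 h2
    rw [← h1, ← h2]
  exact Subtype.ext (poly_eq_of_ae hab ((restrict_element hI) ▸ h3))

/-- On finite element functions `valueAt` is a bounded linear functional. -/
lemma exists_valueAt_clm {I : Set ℝ} {ι : Type} {a b : ι → ℝ} (n : ℕ) (j : ι) (hab : a j < b j)
    (hI : Set.Ioo (a j) (b j) ⊆ I) (x : ℝ) :
    ∃ t : FESpace I (fun j => Set.Ioo (a j) (b j)) n →L[ℂ] ℂ,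
      ∀ u, t u = valueAt (Set.Ioo (a j) (b j)) x (u : H1 I) := by
  let e := LinearEquiv.ofInjective (polyL I (a j) (b j) n) (polyL_injective hab hI n)
  let ev : Polynomial.degreeLE ℂ n →ₗ[ℂ] ℂ :=
    (Polynomial.leval (x : ℂ)) ∘ₗ (Polynomial.degreeLE ℂ n).subtype
  let f : LinearMap.range (polyL I (a j) (b j) n) →L[ℂ] ℂ :=
    LinearMap.toContinuousLinearMap (ev ∘ₗ (e.symm : _ →ₗ[ℂ] _))
  let r : FESpace I (fun j => Set.Ioo (a j) (b j)) n →L[ℂ]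
      LinearMap.range (polyL I (a j) (b j) n) :=
    (resL I (a j) (b j) ∘L (FESpace I (fun j => Set.Ioo (a j) (b j)) n).subtypeL).codRestrict _
      (fun u => (mem_FESpace_iff (u : H1 I)).mp u.2 j)
  refine ⟨f ∘L r, fun u => ?_⟩
  have h : polyL I (a j) (b j) n (e.symm (r u)) = resL I (a j) (b j) (u : H1 I) := by
    have := e.apply_symm_apply (r u)
    exact congrArg Subtype.val this
  rw [valueAt_eq hab hI x (u : H1 I) _ ((resL_eq_iff _ _).mp h)]
  rfl

/-- The hat function at the end of the half-axis. -/
lemma exists_hat {h : ℝ} (hh : 0 < h) {n : ℕ} (hn : 1 ≤ n) :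
    ∃ u ∈ FEHalf h n, valueZero h u = 1 := by
  let p : ℂ[X] := Polynomial.C 1 - Polynomial.C ((h : ℂ)⁻¹) * Polynomial.X
  let q : ℂ[X] := Polynomial.C (-(h : ℂ)⁻¹)
  have hpe : ∀ x : ℝ, p.eval (x : ℂ) = 1 - (h : ℂ)⁻¹ * x := fun x => by simp [p]
  have hqe : ∀ x : ℝ, q.eval (x : ℂ) = -(h : ℂ)⁻¹ := fun x => by simp [q]
  have hf : ∀ r : ℂ[X], MemLp ((Set.Ioo 0 h).indicator fun x : ℝ => r.eval (x : ℂ)) 2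
      (volume.restrict (Set.Ioi 0)) := fun r =>
    (memLp_indicator_iff_restrict measurableSet_Ioo).mpr (memLp_poly 0 h r)
  have hmem : WithLp.toLp 2 ((hf p).toLp _, (hf q).toLp _) ∈ H1 (Set.Ioi 0) := by
    intro η hη
    change ∫ x in Set.Ioi (0 : ℝ), ((deriv η x : ℝ) : ℂ) * (hf p).toLp _ x =
      -∫ x in Set.Ioi (0 : ℝ), (η x : ℂ) * (hf q).toLp _ x
    have key : ∀ (r : ℂ[X]) (θ : ℝ → ℝ), ∫ x in Set.Ioi (0 : ℝ), (θ x : ℂ) * (hf r).toLp _ x =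
        ∫ x in (0 : ℝ)..h, (θ x : ℂ) * r.eval (x : ℂ) := by
      intro r θ
      rw [intervalIntegral.integral_of_le hh.le, integral_Ioc_eq_integral_Ioo]
      have h1 : ∫ x in Set.Ioi (0 : ℝ), (θ x : ℂ) * (hf r).toLp _ x =
          ∫ x in Set.Ioi (0 : ℝ), (Set.Ioo 0 h).indicator
            (fun x : ℝ => (θ x : ℂ) * r.eval (x : ℂ)) x := by
        refine integral_congr_ae ?_
        filter_upwards [(hf r).coeFn_toLp] with x hx
        rw [hx]
        by_cases hx : x ∈ Set.Ioo 0 h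
        · simp only [Set.indicator_of_mem hx]
        · simp only [Set.indicator_of_notMem hx, mul_zero]
      rw [h1, integral_indicator measurableSet_Ioo, restrict_element]
      exact fun x hx => hx.1
    rw [key, key, ← sub_eq_zero, sub_neg_eq_add]
    have hd : ∀ x : ℝ, HasDerivAt (fun y : ℝ => (η y : ℂ)) ((deriv η x : ℝ) : ℂ) x := fun x =>
      ((hη.1.differentiable (by simp)) x).hasDerivAt.ofReal_comp
    have hp : ∀ x : ℝ, HasDerivAt (fun y : ℝ => p.eval (y : ℂ)) (q.eval (x : ℂ)) x := fun x => by
      have h1 : HasDerivAt (fun y : ℝ => (1 : ℂ) - (h : ℂ)⁻¹ * (y : ℂ)) (-(h : ℂ)⁻¹) x := by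
        have := ((Complex.ofRealCLM.hasDerivAt (x := x)).const_mul ((h : ℂ)⁻¹)).const_sub 1
        simpa using this
      simpa only [hpe, hqe] using h1
    have hcη : Continuous (fun x : ℝ => ((deriv η x : ℝ) : ℂ)) :=
      Complex.continuous_ofReal.comp (hη.1.continuous_deriv (by simp))
    have hcq : Continuous (fun x : ℝ => q.eval (x : ℂ)) :=
      q.continuous.comp Complex.continuous_ofReal
    have hcp : Continuous (fun x : ℝ => p.eval (x : ℂ)) :=
      p.continuous.comp Complex.continuous_ofReal
    have hcη' : Continuous (fun x : ℝ => (η x : ℂ)) :=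
      Complex.continuous_ofReal.comp hη.1.continuous
    have hparts := intervalIntegral.integral_deriv_mul_eq_sub (a := 0) (b := h)
      (fun x _ => hd x) (fun x _ => hp x) (hcη.intervalIntegrable _ _)
      (hcq.intervalIntegrable _ _)
    have h0 : η 0 = 0 := by
      refine image_eq_zero_of_notMem_tsupport fun hmem => ?_
      exact lt_irrefl (0 : ℝ) (hη.2.2 hmem)
    have hph : p.eval (h : ℂ) = 0 := by
      rw [hpe]
      have : (h : ℂ) ≠ 0 := by exact_mod_cast hh.ne'
      field_simp
      simp
    rw [h0, hph] at hparts
    refine (intervalIntegral.integral_add ((hcη.mul hcp).intervalIntegrable _ _)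
      ((hcη'.mul hcq).intervalIntegrable _ _)).symm.trans (hparts.trans ?_)
    simp
  let u : H1 (Set.Ioi 0) := ⟨_, hmem⟩
  have hu : val u =ᵐ[volume.restrict (Set.Ioi 0)]
      (Set.Ioo 0 h).indicator fun x : ℝ => p.eval (x : ℂ) := (hf p).coeFn_toLp
  have hset : halfElement h 0 = Set.Ioo 0 h := by simp [halfElement]
  have hu0 : ∀ᵐ y ∂((volume.restrict (Set.Ioi 0)).restrict (Set.Ioo 0 h)),
      val u y = p.eval (y : ℂ) := by
    filter_upwards [ae_restrict_of_ae hu, ae_restrict_mem measurableSet_Ioo] with y h1 h2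
    rw [h1, Set.indicator_of_mem h2]
  refine ⟨u, fun j => ?_, ?_⟩
  · rcases Nat.eq_zero_or_pos j with rfl | hj
    · refine ⟨p, ?_, ?_⟩
      · refine le_trans ?_ hn
        refine (Polynomial.natDegree_sub_le _ _).trans (max_le ?_ ?_)
        · simp
        · exact (Polynomial.natDegree_C_mul_le _ _).trans Polynomial.natDegree_X_le
      · rw [hset]
        exact hu0
    · refine ⟨0, by simp, ?_⟩
      filter_upwards [ae_restrict_of_ae hu, ae_restrict_mem measurableSet_Ioo] with y h1 h2
      rw [h1, Set.indicator_of_notMem, Polynomial.eval_zero]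
      intro h3
      have h4 : (1 : ℝ) ≤ j := by exact_mod_cast hj
      nlinarith [h2.1, h3.2]
  · have h1 : valueAt (Set.Ioo 0 h) 0 u = p.eval ((0 : ℝ) : ℂ) :=
      valueAt_eq hh (fun x hx => hx.1) 0 u p hu0
    rw [valueZero, hset, h1, hpe]
    simp

/-- The kernel of the discrete transparent boundary condition exists. -/
theorem exists_isTBCKernel {ħ ρ B h τ : ℝ} (V : ℝ) {n : ℕ} (hħ : 0 < ħ) (hρ : 0 < ρ) (hB : 0 < B)
    (hh : 0 < h) (hτ : 0 < τ) (hn : 1 ≤ n) : ∃ K, IsTBCKernel ħ ρ B V h τ n K := by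
  have hcl : IsClosed (FEHalf h n : Set (H1 (Set.Ioi 0))) :=
    isClosed_FESpace (fun j : ℕ => (j : ℝ) * h) (fun j : ℕ => ((j : ℝ) + 1) * h) n
  obtain ⟨t, ht⟩ : ∃ t : FEHalf h n →L[ℂ] ℂ, ∀ u, t u = valueZero h (u : H1 (Set.Ioi 0)) := by
    refine exists_valueAt_clm (I := Set.Ioi 0) (a := fun j : ℕ => (j : ℝ) * h)
      (b := fun j : ℕ => ((j : ℝ) + 1) * h) n 0 ?_ ?_ 0
    · simpa using hh
    · intro x hx
      simpa using hx.1
  obtain ⟨w, hw, hw1⟩ := exists_hat hh hn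
  have ha' : 0 < ħ * ρ / τ := by positivity
  have hb' : 0 < ħ ^ 2 / 4 * B := by positivity
  have htw : t ⟨w, hw⟩ = 1 := (ht _).trans hw1
  obtain ⟨κ, hκ⟩ := kernel_sub_aux (FEHalf h n) hcl (valL (Set.Ioi 0)) (DL (Set.Ioi 0))
    H1_norm_sq (c := V / 2) ha' hb' t ⟨w, hw⟩ htw
  have hc : ((ħ ^ 2 / 2 * B : ℝ) : ℂ) ≠ 0 := by
    have : ħ ^ 2 / 2 * B ≠ 0 := by positivity
    exact_mod_cast this
  refine ⟨fun l => κ l / ((ħ ^ 2 / 2 * B : ℝ) : ℂ), fun Φ hΦ => ?_⟩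
  obtain ⟨ψ, hψ0, hψt, hψ⟩ := hκ Φ hΦ
  refine ⟨fun m => ψ m, fun m => (ψ m).2, by simp [hψ0], fun m => by rw [← ht, hψt], ?_⟩
  intro m hm φ hφ
  obtain ⟨m, rfl⟩ : ∃ k, m = k + 1 := ⟨m - 1, by omega⟩
  have h1 := hψ m ⟨φ, hφ⟩
  rw [ht] at h1
  have h2 : ((ħ ^ 2 / 2 * B : ℝ) : ℂ) *
      discreteConv (fun l => κ l / ((ħ ^ 2 / 2 * B : ℝ) : ℂ)) Φ (m + 1) =
      ∑ l ∈ Finset.range (m + 1 + 1), κ l * Φ (m + 1 - l) := by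
    rw [discreteConv, Finset.mul_sum]
    refine Finset.sum_congr rfl fun l _ => ?_
    rw [← mul_assoc, mul_div_cancel₀ _ hc]
  rw [h2, ← h1, massForm_const, formL_const, backDiff, halfSum]
  simp only [Nat.add_sub_cancel, map_smul, map_sub, map_add, inner_smul_right, inner_sub_right, inner_add_right]
  push_cast
  ring

/-- `tbcKernel` has its defining property. -/
theorem isTBCKernel_tbcKernel {ħ ρ B h τ : ℝ} (V : ℝ) {n : ℕ} (hħ : 0 < ħ) (hρ : 0 < ρ)
    (hB : 0 < B) (hh : 0 < h) (hτ : 0 < τ) (hn : 1 ≤ n) :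
    IsTBCKernel ħ ρ B V h τ n (tbcKernel ħ ρ B V h τ n) :=
  Classical.epsilon_spec (exists_isTBCKernel V hħ hρ hB hh hτ hn)

/-! ### The computational domain `Ω = (-X, X)` -/

/-- `Ω = (-X, X)`. -/
abbrev Omega (X : ℝ) : Set ℝ := Set.Ioo (-X) X

/-- The elements of the mesh `x_{-J} < … < x_J`. -/
def meshElement (x : ℤ → ℝ) (J : ℤ) (j : Set.Ioc (-J) J) : Set ℝ :=
  Set.Ioo (x ((j : ℤ) - 1)) (x (j : ℤ))

/-- The finite element space `H_h^{(n)}` on `Ω`. -/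
def FEOmega (X : ℝ) (x : ℤ → ℝ) (J : ℤ) (n : ℕ) : Submodule ℂ (H1 (Omega X)) :=
  FESpace (Omega X) (meshElement x J) n

/-- `φ(X)` for a finite element function on `Ω`. -/
def valueRight (X : ℝ) (x : ℤ → ℝ) (J : ℤ) (φ : H1 (Omega X)) : ℂ :=
  valueAt (Set.Ioo (x (J - 1)) (x J)) X φ

/-- `φ(-X)` for a finite element function on `Ω`. -/
def valueLeft (X : ℝ) (x : ℤ → ℝ) (J : ℤ) (φ : H1 (Omega X)) : ℂ :=
  valueAt (Set.Ioo (x (-J)) (x (-J + 1))) (-X) φ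

/-- The mesh dependent dual norm of `F ∈ H⁻¹(Ω)`: the largest value of `|⟨F, φ⟩|` over the finite
element functions of unit energy norm with shift `v`. -/
def dualNorm (X : ℝ) (x : ℤ → ℝ) (J : ℤ) (n : ℕ) (ħ : ℝ) (ρ B V : ℝ → ℝ) (v : ℝ)
    (F : Hneg1 (Omega X)) : ℝ :=
  sSup {r : ℝ | ∃ φ ∈ FEOmega X x J n, energyNorm (Omega X) ħ ρ B V v φ = 1 ∧ r = ‖F φ‖}

end FEMTBC

end

open FEMTBC

/-!
The scheme at the time level `m` is tested with `χ = i ħ ∂̄_t Ψ^m + v s̄_t Ψ^m`. By hermitian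
symmetry the imaginary part of `𝓛_Ω(s̄_t Ψ^m, χ) + v (ρ s̄_t Ψ^m, χ)` is `-ħ / (2 τ)` times the
increment of `‖Ψ^m‖²` in the energy norm, while the terms with the time derivative and the shift add
up to the real number `(ρ χ, χ)` (`energySq_sub_energySq`).

The same identity holds for the solution of the exterior problem that defines the kernel `K`, with
the Dirichlet values `Ψ^m(X)` (or `Ψ^m(-X)`). Its test function has the value `χ(±X)` at the end of
the half-axis, so each boundary term of the scheme contributes minus the increment of the energy of
an exterior solution. That energy is zero initially, because `Ψ^0(±X) = 0`, and
nonnegative, because `V_∞ + v ρ_∞ ≥ 0` (`exists_exterior_energy`). Hence the total energy of the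
domain and both exteriors changes only by `(2 τ / ħ) Im ⟨F^m, χ⟩` (`exists_total_energy`).

The sum over `m` is bounded after summation by parts of `Re ⟨F^m, ∂̄_t Ψ^m⟩`, which moves the
difference quotient from `Ψ` to `F`, and division by the maximum of the norms
(`le_of_energy_balance`). The dual norms control the values `⟨F, φ⟩` by
`norm_apply_le_dualNorm`; their finiteness comes from the finite dimension of the finite element
space, a function of `H¹(Ω)` being determined by its polynomials on the elements.
-/

namespace FEMTBC

/-! ### Weighted sesquilinear forms on `L²` -/

section WeightedForm

variable {μ : Measure ℝ} {c : ℝ → ℝ}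

lemma integrable_weighted (hc : MemLp c ⊤ μ) (f g : Lp ℂ 2 μ) :
    Integrable (fun x => (c x : ℂ) * f x * conj (g x)) μ := by
  have h1 : Integrable (fun x => f x * conj (g x)) μ := by
    simpa [mul_comm] using L2.integrable_inner (𝕜 := ℂ) g f
  have h2 : Integrable (fun x => (c x : ℂ) * (f x * conj (g x))) μ :=
    memLp_one_iff_integrable.mp ((memLp_one_iff_integrable.mpr h1).mul hc.ofReal)
  simpa only [mul_assoc] using h2

/-- The form `∫ c f ḡ`, linear in `f` and conjugate-linear in `g`. -/
noncomputable def weightedForm (μ : Measure ℝ) (c : ℝ → ℝ) (f g : Lp ℂ 2 μ) : ℂ :=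
  ∫ x, (c x : ℂ) * f x * conj (g x) ∂μ

lemma weightedForm_conj (f g : Lp ℂ 2 μ) :
    conj (weightedForm μ c g f) = weightedForm μ c f g := by
  rw [weightedForm, ← integral_conj, weightedForm]
  refine integral_congr_ae (Filter.Eventually.of_forall fun x => ?_)
  simp only [map_mul, Complex.conj_ofReal, Complex.conj_conj]
  ring

lemma weightedForm_add_left (hc : MemLp c ⊤ μ) (f₁ f₂ g : Lp ℂ 2 μ) :
    weightedForm μ c (f₁ + f₂) g = weightedForm μ c f₁ g + weightedForm μ c f₂ g := by
  rw [weightedForm, weightedForm, weightedForm,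
    ← integral_add (integrable_weighted hc f₁ g) (integrable_weighted hc f₂ g)]
  refine integral_congr_ae ?_
  filter_upwards [Lp.coeFn_add f₁ f₂] with x hx
  rw [hx, Pi.add_apply]
  ring

lemma weightedForm_smul_left (k : ℂ) (f g : Lp ℂ 2 μ) :
    weightedForm μ c (k • f) g = k * weightedForm μ c f g := by
  rw [weightedForm, weightedForm, ← integral_const_mul]
  refine integral_congr_ae ?_
  filter_upwards [Lp.coeFn_smul k f] with x hx
  rw [hx, Pi.smul_apply, smul_eq_mul]
  ring

lemma weightedForm_self (f : Lp ℂ 2 μ) :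
    weightedForm μ c f f = ((∫ x, c x * ‖f x‖ ^ 2 ∂μ : ℝ) : ℂ) := by
  rw [weightedForm, ← integral_complex_ofReal]
  refine integral_congr_ae (Filter.Eventually.of_forall fun x => ?_)
  change (c x : ℂ) * f x * conj (f x) = ((c x * ‖f x‖ ^ 2 : ℝ) : ℂ)
  rw [mul_assoc, Complex.mul_conj, Complex.normSq_eq_norm_sq]
  push_cast
  ring

end WeightedForm

/-! ### The energy form -/

section EnergyForm

variable {I : Set ℝ} {ħ : ℝ} {ρ B V : ℝ → ℝ} {v : ℝ}

/-- The form `𝓛_I(w, φ) + v (ρ w, φ)_{L²(I)}` whose quadratic form is `energySq`. -/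
noncomputable def energyForm (I : Set ℝ) (ħ : ℝ) (ρ B V : ℝ → ℝ) (v : ℝ) (w φ : H1 I) : ℂ :=
  formL I ħ B V w φ + v * massForm I ρ w φ

lemma massForm_eq (w φ : H1 I) :
    massForm I ρ w φ = weightedForm (volume.restrict I) ρ (val w) (val φ) := rfl

lemma formL_eq (w φ : H1 I) :
    formL I ħ B V w φ = ((ħ ^ 2 / 2 : ℝ) : ℂ) * weightedForm (volume.restrict I) B (D w) (D φ) +
      weightedForm (volume.restrict I) V (val w) (val φ) := rfl

lemma val_add (u w : H1 I) : val (u + w) = val u + val w := rfl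
lemma val_smul (k : ℂ) (u : H1 I) : val (k • u) = k • val u := rfl
lemma D_add (u w : H1 I) : D (u + w) = D u + D w := rfl
lemma D_smul (k : ℂ) (u : H1 I) : D (k • u) = k • D u := rfl

lemma massForm_add_left (hρ : MemLp ρ ⊤ (volume.restrict I)) (u w φ : H1 I) :
    massForm I ρ (u + w) φ = massForm I ρ u φ + massForm I ρ w φ := by
  rw [massForm_eq, val_add, weightedForm_add_left hρ]; rfl

lemma massForm_smul_left (k : ℂ) (w φ : H1 I) :
    massForm I ρ (k • w) φ = k * massForm I ρ w φ := by
  rw [massForm_eq, val_smul, weightedForm_smul_left]; rfl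

lemma massForm_self_im (w : H1 I) : (massForm I ρ w w).im = 0 := by
  rw [massForm_eq, weightedForm_self, Complex.ofReal_im]

lemma energyForm_add_left (hρ : MemLp ρ ⊤ (volume.restrict I))
    (hB : MemLp B ⊤ (volume.restrict I)) (hV : MemLp V ⊤ (volume.restrict I)) (u w φ : H1 I) :
    energyForm I ħ ρ B V v (u + w) φ = energyForm I ħ ρ B V v u φ + energyForm I ħ ρ B V v w φ := by
  simp only [energyForm, massForm_add_left hρ, formL_eq, val_add, D_add,
    weightedForm_add_left hB, weightedForm_add_left hV]
  ring

lemma energyForm_smul_left (k : ℂ) (w φ : H1 I) :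
    energyForm I ħ ρ B V v (k • w) φ = k * energyForm I ħ ρ B V v w φ := by
  simp only [energyForm, massForm_smul_left, formL_eq, val_smul, D_smul, weightedForm_smul_left]
  ring

lemma energyForm_conj (w φ : H1 I) :
    conj (energyForm I ħ ρ B V v φ w) = energyForm I ħ ρ B V v w φ := by
  simp only [energyForm, formL_eq, massForm_eq, map_add, map_mul, Complex.conj_ofReal,
    weightedForm_conj]

lemma energyForm_add_right (hρ : MemLp ρ ⊤ (volume.restrict I))
    (hB : MemLp B ⊤ (volume.restrict I)) (hV : MemLp V ⊤ (volume.restrict I)) (w φ χ : H1 I) :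
    energyForm I ħ ρ B V v w (φ + χ) = energyForm I ħ ρ B V v w φ + energyForm I ħ ρ B V v w χ := by
  rw [← energyForm_conj, energyForm_add_left hρ hB hV, map_add, energyForm_conj, energyForm_conj]

lemma energyForm_smul_right (k : ℂ) (w φ : H1 I) :
    energyForm I ħ ρ B V v w (k • φ) = conj k * energyForm I ħ ρ B V v w φ := by
  rw [← energyForm_conj, energyForm_smul_left, map_mul, energyForm_conj]

lemma energyForm_self (w : H1 I) :
    energyForm I ħ ρ B V v w w = (energySq I ħ ρ B V v w : ℂ) := by
  simp only [energyForm, energySq, formL_eq, massForm_eq, weightedForm_self]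
  norm_cast

lemma energySq_zero : energySq I ħ ρ B V v 0 = 0 := by
  have h := energyForm_smul_left (I := I) (ħ := ħ) (ρ := ρ) (B := B) (V := V) (v := v) 0 0 0
  rw [zero_smul, zero_mul, energyForm_self] at h
  exact_mod_cast h

lemma energySq_nonneg (hv : ∀ w : H1 I, w ≠ 0 → 0 < energySq I ħ ρ B V v w) (w : H1 I) :
    0 ≤ energySq I ħ ρ B V v w := by
  rcases eq_or_ne w 0 with rfl | h
  · exact energySq_zero.ge
  · exact (hv w h).le

/-- The energy form as an inner product, when its quadratic form is positive definite. The
arguments are exchanged since `inner` is conjugate-linear in the first one. -/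
noncomputable abbrev energyCore (hρ : MemLp ρ ⊤ (volume.restrict I)) (hB : MemLp B ⊤ (volume.restrict I))
    (hV : MemLp V ⊤ (volume.restrict I))
    (hv : ∀ w : H1 I, w ≠ 0 → 0 < energySq I ħ ρ B V v w) (S : Submodule ℂ (H1 I)) :
    InnerProductSpace.Core ℂ S where
  inner φ w := energyForm I ħ ρ B V v (w : H1 I) (φ : H1 I)
  conj_inner_symm _ _ := energyForm_conj _ _
  re_inner_nonneg w := by
    rw [energyForm_self]
    exact energySq_nonneg hv _
  add_left _ _ _ := energyForm_add_right hρ hB hV _ _ _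
  smul_left _ _ _ := energyForm_smul_right _ _ _
  definite w h := by
    by_contra hw
    rw [energyForm_self] at h
    exact (hv w fun h0 => hw (Subtype.ext h0)).ne' (by exact_mod_cast h)

/-- One step of the Crank–Nicolson scheme, tested with `i ħ ∂̄_t w + v s̄_t w`. This is the function
whose mass form with itself collects the time derivative and the shift, so that only the
energy difference and the remainder have an imaginary part. -/
lemma energySq_sub_energySq (hρ : MemLp ρ ⊤ (volume.restrict I))
    (hB : MemLp B ⊤ (volume.restrict I)) (hV : MemLp V ⊤ (volume.restrict I)) (hħ : 0 < ħ)
    {τ : ℝ} (hτ : 0 < τ) (w : ℕ → H1 I) (m : ℕ) (χ : H1 I) (G : ℂ)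
    (hχ : χ = (Complex.I * ħ) • backDiff τ w m + (v : ℂ) • halfSum w m)
    (hG : Complex.I * ħ * massForm I ρ (backDiff τ w m) χ = formL I ħ B V (halfSum w m) χ + G) :
    energySq I ħ ρ B V v (w m) - energySq I ħ ρ B V v (w (m - 1)) = 2 * τ / ħ * G.im := by
  have h1 : massForm I ρ χ χ = energyForm I ħ ρ B V v (halfSum w m) χ + G := by
    conv_lhs => rw [show massForm I ρ χ χ = massForm I ρ
      ((Complex.I * ħ) • backDiff τ w m + (v : ℂ) • halfSum w m) χ by rw [← hχ]]
    rw [massForm_add_left hρ, massForm_smul_left, massForm_smul_left, hG, energyForm]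
    ring
  have h2 : (energyForm I ħ ρ B V v (halfSum w m) χ).im = - G.im := by
    have := congrArg Complex.im h1
    rw [massForm_self_im, Complex.add_im] at this
    linarith
  have hs : (energyForm I ħ ρ B V v (halfSum w m) (halfSum w m)).im = 0 := by
    rw [energyForm_self, Complex.ofReal_im]
  have hd : (energyForm I ħ ρ B V v (halfSum w m) (backDiff τ w m)).re =
      (2 * τ)⁻¹ * (energySq I ħ ρ B V v (w m) - energySq I ħ ρ B V v (w (m - 1))) := by
    have hx := energyForm_conj (ħ := ħ) (ρ := ρ) (B := B) (V := V) (v := v) (w (m - 1)) (w m)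
    rw [backDiff, halfSum, sub_eq_add_neg, ← neg_one_smul ℂ (w (m - 1))]
    simp only [energyForm_smul_left, energyForm_smul_right, energyForm_add_left hρ hB hV,
      energyForm_add_right hρ hB hV, energyForm_self, ← hx]
    set z := energyForm I ħ ρ B V v (w m) (w (m - 1))
    have : (2 : ℂ)⁻¹ = ((2⁻¹ : ℝ) : ℂ) := by norm_num
    rw [this, ← Complex.ofReal_inv, Complex.conj_ofReal, Complex.re_ofReal_mul]
    simp only [map_neg, map_one, Complex.add_re, Complex.add_im, Complex.mul_re, Complex.mul_im, Complex.neg_re, Complex.one_re,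
      Complex.neg_im, Complex.one_im, Complex.ofReal_re, Complex.ofReal_im,
      Complex.conj_re]
    rw [mul_inv]
    ring
  rw [hχ, energyForm_add_right hρ hB hV, energyForm_smul_right, energyForm_smul_right,
    Complex.conj_ofReal, Complex.add_im, Complex.im_ofReal_mul, hs, map_mul, Complex.conj_I,
    Complex.conj_ofReal, mul_assoc, neg_mul, Complex.neg_im, Complex.I_mul_im,
    Complex.re_ofReal_mul, hd] at h2
  field_simp at h2 ⊢
  linarith

end EnergyForm

/-! ### Finite dimension of the finite element space -/

lemma eq_zero_of_val_eq_zero {I : Set ℝ} (hI : IsOpen I) (u : H1 I) (hu : val u = 0) : u = 0 := by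
  have hD : D u = 0 := by
    have hint : LocallyIntegrableOn (D u) I volume := by
      have h0 : LocallyIntegrable (D u) (volume.restrict I) :=
        (Lp.memLp (D u)).locallyIntegrable (by norm_num)
      exact locallyIntegrableOn_of_locallyIntegrable_restrict h0
    have h := hI.ae_eq_zero_of_integral_contDiff_smul_eq_zero hint fun g hg1 hg2 hg3 => by
      have hw : IsWeakDeriv I (val u) (D u) := u.2
      have h1 := hw g ⟨hg1, hg2, hg3⟩
      rw [hu] at h1
      have h2 : ∫ x in I, ((deriv g x : ℝ) : ℂ) * (0 : L2 I) x = 0 := by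
        rw [integral_eq_zero_of_ae]
        filter_upwards [Lp.coeFn_zero ℂ 2 (volume.restrict I)] with x hx
        change _ * (0 : L2 I) x = 0
        rw [hx, Pi.zero_apply, mul_zero]
      rw [h2, zero_eq_neg] at h1
      rw [← h1]
      refine (setIntegral_eq_integral_of_forall_compl_eq_zero fun x hx => ?_).symm
      rw [image_eq_zero_of_notMem_tsupport fun h => hx (hg3 h)]
      simp
    rw [Lp.eq_zero_iff_ae_eq_zero]
    exact (ae_restrict_iff' hI.measurableSet).mpr h
  apply Subtype.ext
  apply WithLp.ofLp_injective
  exact Prod.ext hu hD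

/-- A finite element function is determined by its polynomials on the elements. -/
lemma finiteDimensional_FESpace {I : Set ℝ} (hI : IsOpen I) {ι : Type} [Finite ι] (a b : ι → ℝ)
    (n : ℕ) (hcov : ∀ᵐ y, y ∈ I → ∃ j, y ∈ Set.Ioo (a j) (b j)) :
    FiniteDimensional ℂ (FESpace I (fun j => Set.Ioo (a j) (b j)) n) := by
  let f : FESpace I (fun j => Set.Ioo (a j) (b j)) n →ₗ[ℂ]
      ∀ j, LinearMap.range (polyL I (a j) (b j) n) :=
    LinearMap.pi fun j => LinearMap.codRestrict _
      ((resL I (a j) (b j) : H1 I →ₗ[ℂ] _) ∘ₗ (FESpace I (fun j => Set.Ioo (a j) (b j)) n).subtype)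
      (fun u => (mem_FESpace_iff (u : H1 I)).mp u.2 j)
  refine Module.Finite.of_injective f ((injective_iff_map_eq_zero f).mpr fun u hu => ?_)
  refine Subtype.ext (eq_zero_of_val_eq_zero hI _ ?_)
  have hj : ∀ j, ∀ᵐ y, y ∈ I → y ∈ Set.Ioo (a j) (b j) → val (u : H1 I) y = 0 := fun j => by
    have h0 : resL I (a j) (b j) (u : H1 I) = 0 := congrArg Subtype.val (congrFun hu j)
    have h1 := (resL_eq_iff (n := n) (u : H1 I) 0).mp (by rw [h0, map_zero])
    have h2 := (ae_restrict_iff' hI.measurableSet).mp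
      ((ae_restrict_iff' measurableSet_Ioo).mp h1)
    filter_upwards [h2] with y hy h3 h4
    simpa using hy h3 h4
  rw [Lp.eq_zero_iff_ae_eq_zero]
  refine (ae_restrict_iff' hI.measurableSet).mpr ?_
  filter_upwards [ae_all_iff.mpr hj, hcov] with y h1 h2 h3
  obtain ⟨j, hy⟩ := h2 h3
  exact h1 j h3 hy

lemma finiteDimensional_FEOmega {X : ℝ} {x : ℤ → ℝ} {J : ℤ} (hx : StrictMono x) (n : ℕ)
    (hx_left : x (-J) = -X) (hx_right : x J = X) :
    FiniteDimensional ℂ (FEOmega X x J n) := by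
  refine finiteDimensional_FESpace isOpen_Ioo (fun j : Set.Ioc (-J) J => x ((j : ℤ) - 1))
    (fun j => x (j : ℤ)) n ?_
  have hnull : ∀ᵐ y : ℝ, y ∉ Set.range x := (Set.countable_range x).ae_notMem _
  filter_upwards [hnull] with y hy hyX
  -- The element of `y` ends at the first node to the right of `y`.
  have hJ : -J < J := hx.lt_iff_lt.mp (by rw [hx_left, hx_right]; exact hyX.1.trans hyX.2)
  obtain ⟨j, ⟨hj1, hj2⟩, hj3⟩ : ∃ j, (-J < j ∧ y < x j) ∧ ∀ i, -J < i ∧ y < x i → j ≤ i :=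
    Int.exists_least_of_bdd ⟨-J, fun z hz => hz.1.le⟩ ⟨J, hJ, hx_right ▸ hyX.2⟩
  refine ⟨⟨j, hj1, hj3 J ⟨hJ, hx_right ▸ hyX.2⟩⟩, ?_, hj2⟩
  by_contra hle
  have hlt : y < x (j - 1) := (not_lt.mp hle).lt_of_ne fun h => hy ⟨_, h.symm⟩
  have hj4 : -J < j - 1 := hx.lt_iff_lt.mp (by rw [hx_left]; exact hyX.1.trans hlt)
  exact absurd (hj3 (j - 1) ⟨hj4, hlt⟩) (by omega)

end FEMTBC

namespace FEMTBC

/-! ### The exterior problem -/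

lemma energySq_const_nonneg {I : Set ℝ} {ħ ρ B V v : ℝ} (hB : 0 ≤ B) (hv : 0 ≤ V + v * ρ)
    (w : H1 I) : 0 ≤ energySq I ħ (fun _ => ρ) (fun _ => B) (fun _ => V) v w := by
  have h := energyForm_self (ħ := ħ) (ρ := fun _ => ρ) (B := fun _ => B) (V := fun _ => V)
    (v := v) w
  rw [energyForm, formL_const, massForm_const, inner_self_eq_norm_sq_to_K,
    inner_self_eq_norm_sq_to_K] at h
  have h' : energySq I ħ (fun _ => ρ) (fun _ => B) (fun _ => V) v w =
      ħ ^ 2 / 2 * B * ‖DL I w‖ ^ 2 + (V + v * ρ) * ‖valL I w‖ ^ 2 := by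
    apply Complex.ofReal_injective
    rw [← h]
    push_cast
    simp only [Complex.coe_algebraMap]
    ring
  rw [h']
  positivity

/-- The value of a finite element function at a point of an element commutes with the
combinations of two time levels that occur in the scheme. -/
lemma valueAt_test {I : Set ℝ} {ι : Type} {a b : ι → ℝ} {n : ℕ} (j : ι) (hab : a j < b j)
    (hI : Set.Ioo (a j) (b j) ⊆ I) (y : ℝ) (k l : ℂ) (τ : ℝ) (w : ℕ → H1 I) (m : ℕ)
    (h1 : w m ∈ FESpace I (fun j => Set.Ioo (a j) (b j)) n)
    (h0 : w (m - 1) ∈ FESpace I (fun j => Set.Ioo (a j) (b j)) n) :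
    valueAt (Set.Ioo (a j) (b j)) y (k • backDiff τ w m + l • halfSum w m) =
      k * backDiff τ (fun i => valueAt (Set.Ioo (a j) (b j)) y (w i)) m +
        l * halfSum (fun i => valueAt (Set.Ioo (a j) (b j)) y (w i)) m := by
  obtain ⟨t, ht⟩ := exists_valueAt_clm (I := I) (a := a) (b := b) n j hab hI y
  have h := ht (k • ((τ : ℂ)⁻¹ • (⟨w m, h1⟩ - ⟨w (m - 1), h0⟩)) +
    l • ((2 : ℂ)⁻¹ • (⟨w (m - 1), h0⟩ + ⟨w m, h1⟩)))
  rw [map_add, map_smul, map_smul, map_smul, map_smul, map_sub, map_add] at h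
  simp only [ht, smul_eq_mul] at h
  simp only [backDiff, halfSum, smul_eq_mul]
  exact h.symm

lemma valueZero_test {h : ℝ} (hh : 0 < h) {n : ℕ} (k l : ℂ) (τ : ℝ) (w : ℕ → H1 (Set.Ioi 0))
    (hw : ∀ m, w m ∈ FEHalf h n) (m : ℕ) :
    valueZero h (k • backDiff τ w m + l • halfSum w m) =
      k * backDiff τ (fun i => valueZero h (w i)) m +
        l * halfSum (fun i => valueZero h (w i)) m := by
  refine valueAt_test (I := Set.Ioi 0) (a := fun j : ℕ => (j : ℝ) * h)
    (b := fun j : ℕ => ((j : ℝ) + 1) * h) 0 ?_ ?_ 0 k l τ w m (hw _) (hw _)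
  · simpa using hh
  · intro x hx
    simpa using hx.1

/-- The imaginary part of the boundary term, tested with `i ħ ∂̄_t Φ^m + v s̄_t Φ^m`, is up to the
factor `2 τ / ħ` the increment of the energy `e` of the exterior solution, which vanishes initially
and is nonnegative. -/
lemma exists_exterior_energy {ħ ρ B V h τ v : ℝ} {n : ℕ} {K : ℕ → ℂ}
    (hK : IsTBCKernel ħ ρ B V h τ n K) (hħ : 0 < ħ) (hB : 0 ≤ B) (hh : 0 < h) (hτ : 0 < τ)
    (hv : 0 ≤ V + v * ρ) (Φ : ℕ → ℂ) (hΦ : Φ 0 = 0) :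
    ∃ e : ℕ → ℝ, e 0 = 0 ∧ (∀ m, 0 ≤ e m) ∧ ∀ m, 1 ≤ m →
      e m - e (m - 1) = 2 * τ / ħ * (((ħ ^ 2 / 2 * B : ℝ) : ℂ) * discreteConv K Φ m *
        conj (Complex.I * ħ * backDiff τ Φ m + v * halfSum Φ m)).im := by
  obtain ⟨ψ, hψ, hψ0, hψΦ, hs⟩ := hK Φ hΦ
  refine ⟨fun m => energySq (Set.Ioi 0) ħ (fun _ => ρ) (fun _ => B) (fun _ => V) v (ψ m), ?_,
    fun m => energySq_const_nonneg hB hv _, fun m hm => ?_⟩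
  · change energySq (Set.Ioi 0) ħ _ _ _ v (ψ 0) = 0
    rw [hψ0, energySq_zero]
  · have hmem : (Complex.I * ħ) • backDiff τ ψ m + (v : ℂ) • halfSum ψ m ∈ FEHalf h n :=
      add_mem (Submodule.smul_mem _ _ (Submodule.smul_mem _ _ (sub_mem (hψ _) (hψ _))))
        (Submodule.smul_mem _ _ (Submodule.smul_mem _ _ (add_mem (hψ _) (hψ _))))
    have h1 := energySq_sub_energySq (v := v) (memLp_top_const ρ) (memLp_top_const B)
      (memLp_top_const V) hħ hτ ψ m _ _ rfl (hs m hm _ hmem)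
    have h2 := valueZero_test hh (Complex.I * ħ) v τ ψ hψ m
    simp only [hψΦ] at h2
    rwa [h2] at h1

/-! ### The dual norm -/

lemma exists_seminorm_of_core {E : Type*} [AddCommGroup E] [Module ℂ E]
    (c : InnerProductSpace.Core ℂ E) :
    ∃ N : Seminorm ℂ E, ∀ u, N u = √(RCLike.re (c.inner u u)) := by
  let _ := c.toNormedAddCommGroup
  let _ := InnerProductSpace.ofCore c.toCore
  exact ⟨normSeminorm ℂ E, fun u => norm_eq_sqrt_re_inner (𝕜 := ℂ) u⟩

lemma exists_bound_of_core {E : Type*} [AddCommGroup E] [Module ℂ E] [FiniteDimensional ℂ E]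
    (c : InnerProductSpace.Core ℂ E) (f : E →ₗ⋆[ℂ] ℂ) :
    ∃ C, ∀ u, ‖f u‖ ≤ C * √(RCLike.re (c.inner u u)) := by
  let _ := c.toNormedAddCommGroup
  let _ := InnerProductSpace.ofCore c.toCore
  let g : E →ₗ[ℂ] ℂ :=
    { toFun := fun u => conj (f u)
      map_add' := fun u w => by simp
      map_smul' := fun k u => by simp }
  refine ⟨‖g.toContinuousLinearMap‖, fun u => ?_⟩
  rw [← norm_eq_sqrt_re_inner (𝕜 := ℂ) u]
  have h := g.toContinuousLinearMap.le_opNorm u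
  change ‖conj (f u)‖ ≤ _ at h
  rwa [RCLike.norm_conj] at h

section DualNorm

variable {X : ℝ} {x : ℤ → ℝ} {J : ℤ} {n : ℕ} {ħ : ℝ} {ρ B V : ℝ → ℝ} {v : ℝ}

lemma dualNorm_nonneg (F : Hneg1 (Omega X)) : 0 ≤ dualNorm X x J n ħ ρ B V v F :=
  Real.sSup_nonneg (by rintro _ ⟨φ, -, -, rfl⟩; exact norm_nonneg _)

lemma energyNorm_eq_sqrt_re (w : H1 (Omega X)) :
    energyNorm (Omega X) ħ ρ B V v w =
      √(RCLike.re (energyForm (Omega X) ħ ρ B V v w w)) := by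
  rw [energyForm_self]
  rfl

/-- The energy norm on the finite element space, as a seminorm. -/
lemma exists_energySeminorm (hρ : MemLp ρ ⊤ volume) (hB : MemLp B ⊤ volume)
    (hV : MemLp V ⊤ volume)
    (hv : ∀ w : H1 (Omega X), w ≠ 0 → 0 < energySq (Omega X) ħ ρ B V v w) :
    ∃ N : Seminorm ℂ (FEOmega X x J n),
      ∀ u, N u = energyNorm (Omega X) ħ ρ B V v (u : H1 (Omega X)) := by
  obtain ⟨N, hN⟩ := exists_seminorm_of_core
    (energyCore (hρ.restrict _) (hB.restrict _) (hV.restrict _) hv (FEOmega X x J n))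
  refine ⟨N, fun u => ?_⟩
  rw [hN, energyNorm_eq_sqrt_re]
  rfl

/-- The supremum in the dual norm is finite because the finite element space is
finite-dimensional. -/
lemma norm_apply_le_dualNorm (hρ : MemLp ρ ⊤ volume) (hB : MemLp B ⊤ volume)
    (hV : MemLp V ⊤ volume) (hx : StrictMono x) (hx_left : x (-J) = -X) (hx_right : x J = X)
    (hv : ∀ w : H1 (Omega X), w ≠ 0 → 0 < energySq (Omega X) ħ ρ B V v w)
    (F : Hneg1 (Omega X)) {φ : H1 (Omega X)} (hφ : φ ∈ FEOmega X x J n) :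
    ‖F φ‖ ≤ dualNorm X x J n ħ ρ B V v F * energyNorm (Omega X) ħ ρ B V v φ := by
  have := finiteDimensional_FEOmega hx n hx_left hx_right
  by_cases h0 : φ = 0
  · rw [h0, map_zero, norm_zero]
    exact mul_nonneg (dualNorm_nonneg F) (Real.sqrt_nonneg _)
  have hpos : 0 < energyNorm (Omega X) ħ ρ B V v φ := Real.sqrt_pos.mpr (hv φ h0)
  let c := energyCore (hρ.restrict _) (hB.restrict _) (hV.restrict _) hv (FEOmega X x J n)
  obtain ⟨C, hC⟩ := exists_bound_of_core c
    ((F : H1 (Omega X) →ₗ⋆[ℂ] ℂ) ∘ₛₗ (FEOmega X x J n).subtype)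
  have hbdd : BddAbove {r : ℝ | ∃ φ ∈ FEOmega X x J n,
      energyNorm (Omega X) ħ ρ B V v φ = 1 ∧ r = ‖F φ‖} := by
    refine ⟨C, ?_⟩
    rintro _ ⟨χ, hχ, hχ1, rfl⟩
    have h := hC ⟨χ, hχ⟩
    have h1 : √(RCLike.re (c.inner ⟨χ, hχ⟩ ⟨χ, hχ⟩)) = 1 := by
      rw [← hχ1, energyNorm_eq_sqrt_re]
      rfl
    rw [h1, mul_one] at h
    exact h
  obtain ⟨N, hN⟩ := exists_energySeminorm (x := x) (J := J) (n := n) hρ hB hV hv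
  set r := energyNorm (Omega X) ħ ρ B V v φ with hr
  have hunit : energyNorm (Omega X) ħ ρ B V v ((r⁻¹ : ℂ) • φ) = 1 := by
    have h1 := hN ((r⁻¹ : ℂ) • ⟨φ, hφ⟩)
    rw [map_smul_eq_mul, hN, norm_inv, Complex.norm_real, Real.norm_of_nonneg hpos.le] at h1
    change r⁻¹ * r = _ at h1
    rw [inv_mul_cancel₀ hpos.ne'] at h1
    exact h1.symm
  have h2 := le_csSup hbdd ⟨_, Submodule.smul_mem _ _ hφ, hunit, rfl⟩
  rw [map_smulₛₗ, norm_smul, RCLike.norm_conj, norm_inv, Complex.norm_real,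
    Real.norm_of_nonneg hpos.le, inv_mul_le_iff₀ hpos, mul_comm] at h2
  exact h2

end DualNorm

/-! ### Summation in time -/

/-- The energy balance with sources, summed by parts in time, bounds the energy norm. The energy
`𝓔` may exceed the squared norm at positive times (by the energy of the exterior). -/
lemma le_of_energy_balance {E : Type*} [AddCommGroup E] [Module ℂ E] (N : Seminorm ℂ E) (M : ℕ)
    {τ ħ : ℝ} (hτ : 0 < τ) (hħ : 0 < ħ) (v : ℝ) (F : ℕ → E →ₗ⋆[ℂ] ℂ) (d δ : ℕ → ℝ)
    (hd0 : ∀ k, 0 ≤ d k) (hδ0 : ∀ k, 0 ≤ δ k) (hd : ∀ k u, ‖F k u‖ ≤ d k * N u)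
    (hδ : ∀ k u, ‖F k u - F (k - 1) u‖ ≤ τ * δ k * N u) (Y : ℕ → E) (𝓔 : ℕ → ℝ)
    (h𝓔0 : 𝓔 0 = N (Y 0) ^ 2) (h𝓔 : ∀ m ≤ M, N (Y m) ^ 2 ≤ 𝓔 m)
    (hstep : ∀ m, 1 ≤ m → m ≤ M → 𝓔 m - 𝓔 (m - 1) =
      2 * τ / ħ * (F m ((Complex.I * ħ) • backDiff τ Y m + (v : ℂ) • halfSum Y m)).im) :
    ∀ m ≤ M, N (Y m) ≤ N (Y 0) +
      4 * ∑ k ∈ Finset.Icc 1 M, (|v| / ħ * d k + δ k) * τ + 4 * d 0 := by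
  obtain ⟨m₀, hm₀, hmax⟩ := Finset.exists_max_image (Finset.range (M + 1)) (fun m => N (Y m))
    ⟨0, by simp⟩
  have hm₀M : m₀ ≤ M := Nat.lt_succ_iff.mp (Finset.mem_range.mp hm₀)
  have hle : ∀ m ≤ M, N (Y m) ≤ N (Y m₀) := fun m hm =>
    hmax m (Finset.mem_range.mpr (Nat.lt_succ_iff.mpr hm))
  set P := N (Y m₀) with hP
  have hP0 : 0 ≤ P := apply_nonneg N _
  set S : ℕ → ℝ := fun m => ∑ k ∈ Finset.Icc 1 m, (|v| / ħ * d k + δ k) * τ with hS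
  have hterm : ∀ k, 0 ≤ |v| / ħ * d k * τ := fun k => by have := hd0 k; positivity
  have hterm' : ∀ k, 0 ≤ (|v| / ħ * d k + δ k) * τ := fun k => by
    have := hd0 k
    have := hδ0 k
    positivity
  have hSsucc : ∀ m, S (m + 1) = S m + (|v| / ħ * d (m + 1) + δ (m + 1)) * τ := fun m =>
    Finset.sum_Icc_succ_top (by omega) _
  have hSmono : S m₀ ≤ S M := Finset.sum_le_sum_of_subset_of_nonneg
    (Finset.Icc_subset_Icc le_rfl hm₀M) fun k _ _ => hterm' k
  have hF : ∀ m u, ‖F m u‖ ≤ (d 0 + S m) * N u := by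
    intro m u
    induction m with
    | zero => simpa [hS] using hd 0 u
    | succ m ih =>
      have h1 := hδ (m + 1) u
      rw [Nat.add_sub_cancel] at h1
      have h2 := norm_le_norm_add_norm_sub' (F (m + 1) u) (F m u)
      have h3 := mul_nonneg (hterm (m + 1)) (apply_nonneg N u)
      rw [hSsucc]
      linarith
  -- Summation by parts: the terms `⟨F^m, Y^m⟩` telescope, and only differences of `F` remain.
  have hsum : ∀ m ≤ M, 𝓔 m + 2 * (F m (Y m)).re ≤ 𝓔 0 + 2 * (F 0 (Y 0)).re + 2 * P * S m := by
    intro m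
    induction m with
    | zero => simp [hS]
    | succ m ih =>
      intro hm
      have h0 := ih (by omega)
      have h1 := hstep (m + 1) (by omega) hm
      have h2 := hδ (m + 1) (Y m)
      have h3 := hd (m + 1) (halfSum Y (m + 1))
      rw [Nat.add_sub_cancel] at h1 h2
      have hhalf : N (halfSum Y (m + 1)) ≤ P := by
        rw [halfSum, map_smul_eq_mul, Nat.add_sub_cancel]
        have h4 := map_add_le_add N (Y m) (Y (m + 1))
        have h5 := hle m (by omega)
        have h6 := hle (m + 1) hm
        norm_num
        linarith
      have h4 : τ * (F (m + 1) (backDiff τ Y (m + 1))).re =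
          (F (m + 1) (Y (m + 1))).re - (F (m + 1) (Y m)).re := by
        rw [backDiff, map_smulₛₗ, Nat.add_sub_cancel, map_sub, ← Complex.ofReal_inv,
          Complex.conj_ofReal, smul_eq_mul, Complex.re_ofReal_mul, Complex.sub_re]
        field_simp
      have h5 : (F (m + 1) ((Complex.I * ħ) • backDiff τ Y (m + 1) +
          (v : ℂ) • halfSum Y (m + 1))).im = - (ħ * (F (m + 1) (backDiff τ Y (m + 1))).re) +
            v * (F (m + 1) (halfSum Y (m + 1))).im := by
        rw [map_add, map_smulₛₗ, map_smulₛₗ, Complex.conj_ofReal, map_mul, Complex.conj_I,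
          Complex.conj_ofReal, smul_eq_mul, smul_eq_mul, Complex.add_im, Complex.im_ofReal_mul,
          mul_assoc, neg_mul, Complex.neg_im, Complex.I_mul_im, Complex.re_ofReal_mul]
      have h6 : 𝓔 (m + 1) - 𝓔 m =
          -2 * ((F (m + 1) (Y (m + 1))).re - (F (m + 1) (Y m)).re) +
            2 * (τ * (v / ħ * (F (m + 1) (halfSum Y (m + 1))).im)) := by
        rw [h1, h5, ← h4]
        field_simp
      have h7 : v / ħ * (F (m + 1) (halfSum Y (m + 1))).im ≤ |v| / ħ * (d (m + 1) * P) := by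
        refine (le_abs_self _).trans ?_
        rw [abs_mul, abs_div, abs_of_pos hħ]
        refine mul_le_mul_of_nonneg_left ?_ (by positivity)
        exact (Complex.abs_im_le_norm _).trans
          (h3.trans (mul_le_mul_of_nonneg_left hhalf (hd0 _)))
      have h8 : (F (m + 1) (Y m)).re - (F m (Y m)).re ≤ τ * δ (m + 1) * P := by
        rw [← Complex.sub_re]
        refine (Complex.re_le_norm _).trans (h2.trans ?_)
        exact mul_le_mul_of_nonneg_left (hle m (by omega)) (mul_nonneg hτ.le (hδ0 _))
      have h9 := mul_le_mul_of_nonneg_left h7 hτ.le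
      rw [hSsucc]
      linarith
  -- Both end terms of the summation by parts contribute `d 0`, and `F^{m₀}` a second copy of the sum.
  have hfin : P * P ≤ P * (N (Y 0) + 4 * S M + 4 * d 0) := by
    have h1 := hsum m₀ hm₀M
    have h2 := h𝓔 m₀ hm₀M
    rw [← hP] at h2
    have h3 := (neg_le_abs _).trans ((Complex.abs_re_le_norm _).trans (hF m₀ (Y m₀)))
    have h4 := (Complex.re_le_norm _).trans (hd 0 (Y 0))
    have h5 : N (Y 0) * N (Y 0) ≤ N (Y 0) * P :=
      mul_le_mul_of_nonneg_left (hle 0 (Nat.zero_le _)) (apply_nonneg N _)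
    have h6 := mul_le_mul_of_nonneg_left (hle 0 (Nat.zero_le _)) (hd0 0)
    have h7 := mul_le_mul_of_nonneg_left hSmono hP0
    rw [h𝓔0] at h1
    rw [← hP] at h3
    nlinarith
  have hconcl : P ≤ N (Y 0) + 4 * S M + 4 * d 0 := by
    rcases hP0.eq_or_lt with h0 | h0
    · have h1 : 0 ≤ S M := Finset.sum_nonneg fun k _ => hterm' k
      have h2 := apply_nonneg N (Y 0)
      have h3 := hd0 0
      rw [← h0]
      positivity
    · exact le_of_mul_le_mul_left hfin h0
  exact fun m hm => (hle m hm).trans hconcl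

end FEMTBC

namespace FEMTBC

/-! ### The energy balance on the computational domain -/

section Domain

variable {X : ℝ} {x : ℤ → ℝ} {J : ℤ} {n : ℕ}

lemma valueRight_test (hx : StrictMono x) (hx_left : x (-J) = -X) (hx_right : x J = X)
    (hJ : -J < J) (k l : ℂ) (τ : ℝ) (w : ℕ → H1 (Omega X))
    (hw : ∀ m, w m ∈ FEOmega X x J n) (m : ℕ) :
    valueRight X x J (k • backDiff τ w m + l • halfSum w m) =
      k * backDiff τ (fun i => valueRight X x J (w i)) m +
        l * halfSum (fun i => valueRight X x J (w i)) m :=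
  valueAt_test (I := Omega X) (a := fun j : Set.Ioc (-J) J => x ((j : ℤ) - 1))
    (b := fun j => x (j : ℤ)) ⟨J, hJ, le_rfl⟩ (hx (by simp))
    (Set.Ioo_subset_Ioo (hx_left ▸ hx.monotone (by dsimp only; omega)) hx_right.le) X k l τ w m
    (hw _) (hw _)

lemma valueLeft_test (hx : StrictMono x) (hx_left : x (-J) = -X) (hx_right : x J = X)
    (hJ : -J < J) (k l : ℂ) (τ : ℝ) (w : ℕ → H1 (Omega X))
    (hw : ∀ m, w m ∈ FEOmega X x J n) (m : ℕ) :
    valueLeft X x J (k • backDiff τ w m + l • halfSum w m) =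
      k * backDiff τ (fun i => valueLeft X x J (w i)) m +
        l * halfSum (fun i => valueLeft X x J (w i)) m := by
  have h := valueAt_test (I := Omega X) (a := fun j : Set.Ioc (-J) J => x ((j : ℤ) - 1))
    (b := fun j => x (j : ℤ)) ⟨-J + 1, by omega, by omega⟩ (hx (by simp))
    (Set.Ioo_subset_Ioo (by simp [hx_left])
      ((hx.monotone (by change -J + 1 ≤ J; omega)).trans_eq hx_right)) (-X) k l τ w m (hw _) (hw _)
  simpa only [add_sub_cancel_right, valueLeft] using h

/-- The scheme determines the increments of the total energy, that of the computational domain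
and of the two exterior half-axes: the boundary terms cancel and only the source remains. -/
lemma exists_total_energy {ħ : ℝ} (hħ : 0 < ħ) {ρ B V : ℝ → ℝ} (hρ : MemLp ρ ⊤ volume)
    (hB : MemLp B ⊤ volume) (hV : MemLp V ⊤ volume) {ρinf Binf Vinf h τ v : ℝ}
    (hBinf : 0 ≤ Binf) (hh : 0 < h) (hτ : 0 < τ) (hv_inf : 0 ≤ Vinf + v * ρinf)
    (hx : StrictMono x) (hx_left : x (-J) = -X) (hx_right : x J = X) (hJ : -J < J)
    {K : ℕ → ℂ} (hK : IsTBCKernel ħ ρinf Binf Vinf h τ n K) (F : ℕ → Hneg1 (Omega X))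
    (Ψ : ℕ → H1 (Omega X)) (hΨ : ∀ m, Ψ m ∈ FEOmega X x J n)
    (hΨ_right : valueRight X x J (Ψ 0) = 0) (hΨ_left : valueLeft X x J (Ψ 0) = 0) (M : ℕ)
    (hscheme : ∀ m, 1 ≤ m → m ≤ M → ∀ φ ∈ FEOmega X x J n,
      Complex.I * ħ * massForm (Omega X) ρ (backDiff τ Ψ m) φ =
        formL (Omega X) ħ B V (halfSum Ψ m) φ
        - ((ħ ^ 2 / 2 * Binf : ℝ) : ℂ) *
            discreteConv K (fun l => valueRight X x J (Ψ l)) m * conj (valueRight X x J φ)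
        - ((ħ ^ 2 / 2 * Binf : ℝ) : ℂ) *
            discreteConv K (fun l => valueLeft X x J (Ψ l)) m * conj (valueLeft X x J φ)
        + F m φ) :
    ∃ 𝓔 : ℕ → ℝ, 𝓔 0 = energySq (Omega X) ħ ρ B V v (Ψ 0) ∧
      (∀ m, energySq (Omega X) ħ ρ B V v (Ψ m) ≤ 𝓔 m) ∧
      ∀ m, 1 ≤ m → m ≤ M → 𝓔 m - 𝓔 (m - 1) = 2 * τ / ħ *
        (F m ((Complex.I * ħ) • backDiff τ Ψ m + (v : ℂ) • halfSum Ψ m)).im := by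
  obtain ⟨e, he0, he, hes⟩ := exists_exterior_energy hK hħ hBinf hh hτ hv_inf
    (fun l => valueRight X x J (Ψ l)) hΨ_right
  obtain ⟨e', he0', he', hes'⟩ := exists_exterior_energy hK hħ hBinf hh hτ hv_inf
    (fun l => valueLeft X x J (Ψ l)) hΨ_left
  refine ⟨fun m => energySq (Omega X) ħ ρ B V v (Ψ m) + e m + e' m, ?_, fun m => ?_,
    fun m hm hmM => ?_⟩
  · simp only [he0, he0', add_zero]
  · linarith [he m, he' m]
  · have hmem : (Complex.I * ħ) • backDiff τ Ψ m + (v : ℂ) • halfSum Ψ m ∈ FEOmega X x J n :=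
      add_mem (Submodule.smul_mem _ _ (Submodule.smul_mem _ _ (sub_mem (hΨ _) (hΨ _))))
        (Submodule.smul_mem _ _ (Submodule.smul_mem _ _ (add_mem (hΨ _) (hΨ _))))
    have h0 := hscheme m hm hmM _ hmem
    rw [sub_eq_add_neg, sub_eq_add_neg, add_assoc, add_assoc] at h0
    have h1 := energySq_sub_energySq (v := v) (hρ.restrict _) (hB.restrict _) (hV.restrict _)
      hħ hτ Ψ m _ _ rfl h0
    rw [valueRight_test hx hx_left hx_right hJ _ _ τ Ψ hΨ,
      valueLeft_test hx hx_left hx_right hJ _ _ τ Ψ hΨ, Complex.add_im, Complex.add_im,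
      Complex.neg_im, Complex.neg_im] at h1
    linear_combination h1 + hes m hm + hes' m hm

end Domain

lemma pos_of_ae_le_of_ae_eq {ρ : ℝ → ℝ} {a r b : ℝ} (ha : 0 < a) (h1 : ∀ᵐ y, a ≤ ρ y)
    (h2 : ∀ᵐ y, b ≤ |y| → ρ y = r) : 0 < r := by
  have h : ∀ᵐ y ∂(volume.restrict (Set.Ioi b)), a ≤ r := by
    filter_upwards [ae_restrict_of_ae h1, ae_restrict_of_ae h2, ae_restrict_mem measurableSet_Ioi]
      with y h1 h2 h3
    rw [← h2 (h3.le.trans (le_abs_self y))]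
    exact h1
  have : (ae (volume.restrict (Set.Ioi b))).NeBot := ae_restrict_neBot.mpr (by simp)
  exact ha.trans_le h.exists.choose_spec

end FEMTBC

theorem proposition2
    -- physical constant and coefficients
    (ħ : ℝ) (hħ : 0 < ħ)
    (ρ B V : ℝ → ℝ) (hρ : MemLp ρ ⊤ volume) (hB : MemLp B ⊤ volume) (hV : MemLp V ⊤ volume)
    (ρlow Blow : ℝ) (hρlow : 0 < ρlow) (hBlow : 0 < Blow)
    (hρ_ge : ∀ᵐ y, ρlow ≤ ρ y) (hB_ge : ∀ᵐ y, Blow ≤ B y)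
    (ρinf Binf Vinf X₀ X : ℝ) (hBinf : 0 < Binf) (hX₀ : 0 < X₀) (hX : X₀ < X)
    (hρ_eq : ∀ᵐ y, X₀ ≤ |y| → ρ y = ρinf) (hB_eq : ∀ᵐ y, X₀ ≤ |y| → B y = Binf)
    (hV_eq : ∀ᵐ y, X₀ ≤ |y| → V y = Vinf)
    -- space mesh and degree
    (x : ℤ → ℝ) (hx : StrictMono x) (J : ℤ) (h : ℝ)
    (hx_left : x (-J) = -X) (hx_right : x J = X)
    (hx_left' : x (-J + 1) ≤ -X₀) (hx_right' : X₀ ≤ x (J - 1))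
    (hx_unif : ∀ j : ℤ, j ≤ -J + 1 ∨ J ≤ j → x j - x (j - 1) = h)
    (n : ℕ) (hn : 1 ≤ n)
    -- time mesh
    (T : ℝ) (hT : 0 < T) (M : ℕ) (hM : 1 ≤ M) (τ : ℝ) (hτ : τ = T / M)
    -- the shift
    (v : ℝ) (hv : ∀ w : H1 (Omega X), w ≠ 0 → 0 < energySq (Omega X) ħ ρ B V v w)
    (hv_inf : 0 ≤ Vinf + v * ρinf)
    -- the sources and the approximate solution
    (F : ℕ → Hneg1 (Omega X)) (Ψ : ℕ → H1 (Omega X))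
    (hΨ : ∀ m ≤ M, Ψ m ∈ FEOmega X x J n)
    (hΨ_right : valueRight X x J (Ψ 0) = 0) (hΨ_left : valueLeft X x J (Ψ 0) = 0)
    (hscheme : ∀ m, 1 ≤ m → m ≤ M → ∀ φ ∈ FEOmega X x J n,
      Complex.I * ħ * massForm (Omega X) ρ (backDiff τ Ψ m) φ =
        formL (Omega X) ħ B V (halfSum Ψ m) φ
        - ((ħ ^ 2 / 2 * Binf : ℝ) : ℂ) *
            SRef ħ ρinf Binf Vinf h τ n (fun l => valueRight X x J (Ψ l)) m *
            conj (valueRight X x J φ)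
        - ((ħ ^ 2 / 2 * Binf : ℝ) : ℂ) *
            SRef ħ ρinf Binf Vinf h τ n (fun l => valueLeft X x J (Ψ l)) m *
            conj (valueLeft X x J φ)
        + F m φ) :
    ∀ m ≤ M, energyNorm (Omega X) ħ ρ B V v (Ψ m) ≤
      energyNorm (Omega X) ħ ρ B V v (Ψ 0)
      + 4 * ∑ k ∈ Finset.Icc 1 M,
          (|v| / ħ * dualNorm X x J n ħ ρ B V v (F k)
            + dualNorm X x J n ħ ρ B V v (backDiff τ F k)) * τ
      + 4 * dualNorm X x J n ħ ρ B V v (F 0) := by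
  have hMpos : (0 : ℝ) < M := by exact_mod_cast hM
  have hτpos : 0 < τ := hτ ▸ div_pos hT hMpos
  have hρinf : 0 < ρinf := pos_of_ae_le_of_ae_eq hρlow hρ_ge hρ_eq
  have hh : 0 < h := by
    rw [← hx_unif J (Or.inr le_rfl), sub_pos]
    exact hx (by omega)
  have hJ : -J < J := hx.lt_iff_lt.mp (by rw [hx_left, hx_right]; linarith)
  have hK := isTBCKernel_tbcKernel Vinf hħ hρinf hBinf hh hτpos hn
  -- `Ψ` is continued by zero beyond the last time level.
  let Y : ℕ → FEOmega X x J n := fun m => if hm : m ≤ M then ⟨Ψ m, hΨ m hm⟩ else 0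
  have hY : ∀ m ≤ M, (Y m : H1 (Omega X)) = Ψ m := fun m hm => by simp only [Y, dif_pos hm]
  have hconv : ∀ (f : H1 (Omega X) → ℂ) (m : ℕ), m ≤ M →
      SRef ħ ρinf Binf Vinf h τ n (fun l => f (Ψ l)) m =
        discreteConv (tbcKernel ħ ρinf Binf Vinf h τ n) (fun l => f (Y l)) m := fun f m hm => by
    rw [SRef, discreteConv, discreteConv]
    exact Finset.sum_congr rfl fun l _ => by rw [hY (m - l) (by omega)]
  obtain ⟨𝓔, h𝓔0, h𝓔, hstep⟩ := exists_total_energy (v := v) hħ hρ hB hV hBinf.le hh hτpos hv_inf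
    hx hx_left hx_right hJ hK F (fun m => Y m) (fun m => (Y m).2)
    (by rw [hY 0 (Nat.zero_le _), hΨ_right]) (by rw [hY 0 (Nat.zero_le _), hΨ_left]) M
    (by
      intro m hm hmM φ hφ
      have hs := hscheme m hm hmM φ hφ
      rw [hconv (valueRight X x J) m hmM, hconv (valueLeft X x J) m hmM] at hs
      have hb : backDiff τ (fun m => (Y m : H1 (Omega X))) m = backDiff τ Ψ m := by
        rw [backDiff, backDiff, hY m hmM, hY (m - 1) (by omega)]
      have hs' : halfSum (fun m => (Y m : H1 (Omega X))) m = halfSum Ψ m := by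
        rw [halfSum, halfSum, hY m hmM, hY (m - 1) (by omega)]
      rw [hb, hs']
      exact hs)
  obtain ⟨N, hN⟩ := exists_energySeminorm (x := x) (J := J) (n := n) hρ hB hV hv
  have hNsq : ∀ u : FEOmega X x J n,
      N u ^ 2 = energySq (Omega X) ħ ρ B V v (u : H1 (Omega X)) := fun u => by
    rw [hN, energyNorm, Real.sq_sqrt (energySq_nonneg hv _)]
  have hdual : ∀ (G : Hneg1 (Omega X)) (u : FEOmega X x J n),
      ‖G (u : H1 (Omega X))‖ ≤ dualNorm X x J n ħ ρ B V v G * N u := fun G u => by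
    rw [hN]
    exact norm_apply_le_dualNorm hρ hB hV hx hx_left hx_right hv G u.2
  have hmain := le_of_energy_balance N M hτpos hħ v
    (fun k => (F k : H1 (Omega X) →ₗ⋆[ℂ] ℂ) ∘ₛₗ (FEOmega X x J n).subtype)
    (fun k => dualNorm X x J n ħ ρ B V v (F k))
    (fun k => dualNorm X x J n ħ ρ B V v (backDiff τ F k))
    (fun k => dualNorm_nonneg _) (fun k => dualNorm_nonneg _) (fun k u => hdual (F k) u)
    (fun k u => by
      have h1 := hdual (backDiff τ F k) u
      have h2 : backDiff τ F k (u : H1 (Omega X)) =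
        (τ : ℂ)⁻¹ * (F k (u : H1 (Omega X)) - F (k - 1) (u : H1 (Omega X))) := rfl
      rw [h2, norm_mul, norm_inv, Complex.norm_real, Real.norm_of_nonneg hτpos.le,
        inv_mul_le_iff₀ hτpos, ← mul_assoc] at h1
      exact h1)
    Y 𝓔 (by rw [h𝓔0, hNsq]) (fun m _ => by rw [hNsq]; exact h𝓔 m) hstep
  intro m hm
  have hfin := hmain m hm
  rwa [hN, hN, hY m hm, hY 0 (Nat.zero_le _)] at hfin
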